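/- A Weil algebra is a commutative unital real algebra $A=\mathbb R\cdot 1\oplus N_A$, $1\neq 0$, of finite dimension over $\mathbb R$, whose ideal $N_A$ consists of nilpotent elements. Its width $k$ is the least number of elements of $N_A$ that generate $A$; a choice of such generators $a_1,\dots,a_k$ determines a surjective algebra homomorphism $j^A$ from the algebra of germs at $0$ of smooth functions on $\mathbb R^k$ onto $A$, which sends a germ to its Taylor polynomial at $0$ (of sufficiently high order) evaluated at $(a_1,\dots,a_k)$. Let $M$ be a smooth finite-dimensional manifold. Smooth maps $g,h:\mathbb R^k\to M$ determine the same $A$-velocity, $j^Ag=j^Ah$, if $g(0)=h(0)$ and $j^A(f\circ g)=j^A(f\circ h)$ for all germs $f$ of smooth functions on $M$ at $g(0)$. The Weil bundle $T^AM$ is the set of all $A$-velocities; it is a smooth manifold with the charts induced by those of $M$, $p^A_M:T^AM\to M$, $j^Ag\mapsto g(0)$, is its (smooth) bundle projection, and for a smooth map $f:M\to M'$ the smooth map $T^Af:T^AM\to T^AM'$ is defined by $T^Af(j^Ag)=j^A(f\circ g)$. In particular $T^A\mathbb R=A$. For Weil algebras $A,B$, the exchange isomorphism $A\otimes B\to B\otimes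 A$, $a\otimes b\mapsto b\otimes a$, induces the exchange natural transformation $\kappa^{A,B}_M:T^AT^BM\to T^BT^AM$: for $z\in T^AT^BM$, the element $\kappa^{A,B}_M(z)$ is the unique element of $T^BT^AM$ over the same point $x$ of $M$ such that, for every germ $f$ of a smooth function on $M$ at $x$, the value of $T^BT^Af$ at $\kappa^{A,B}_M(z)$, an element of $B\otimes A$, is the image of the value of $T^AT^Bf$ at $z$, an element of $A\otimes B$, under the exchange isomorphism. The map $\kappa^{A,B}_M$ is smooth. **Lemma.** Let $A,B,C$ be Weil algebras and $M$ a smooth finite-dimensional manifold. Then $$p^B_{T^CT^AM}\circ T^B\kappa^{A,C}_M\circ\kappa^{A,B}_{T^CM}=\kappa^{A,C}_M\circ T^Ap^B_{T^CM}$$ as maps $T^AT^BT^CM\to T^CT^AM$. -/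

import Mathlib

open scoped Manifold ContDiff TensorProduct Topology

namespace Weil

/-- A Weil algebra: a commutative unital real algebra `A = ℝ·1 ⊕ N`, `1 ≠ 0`, of finite dimension,
in which `N` consists of nilpotent elements (then `N` is the nilradical of `A`). -/
class WeilAlgebra (A : Type*) [CommRing A] [Algebra ℝ A] : Prop where
  finite : Module.Finite ℝ A
  nontrivial : Nontrivial A
  exists_real_part : ∀ a : A, ∃ r : ℝ, IsNilpotent (a - algebraMap ℝ A r)

attribute [instance] WeilAlgebra.finite

section Algebra

variable (A : Type*) [CommRing A] [Algebra ℝ A] [WeilAlgebra A]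

theorem exists_realPart : ∃ ρ : A →ₐ[ℝ] ℝ, ∀ a, IsNilpotent (a - algebraMap ℝ A (ρ a)) := by
  have := WeilAlgebra.nontrivial (A := A)
  choose ρ hρ using WeilAlgebra.exists_real_part (A := A)
  have key : ∀ (a : A) (r : ℝ), IsNilpotent (a - algebraMap ℝ A r) → ρ a = r := by
    intro a r h
    have h2 : IsNilpotent (algebraMap ℝ A (ρ a - r)) := by
      have := (Commute.all _ _).isNilpotent_sub h (hρ a)
      simpa using this
    rw [IsNilpotent.map_iff (algebraMap ℝ A).injective] at h2
    have := h2.eq_zero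
    linarith
  refine ⟨AlgHom.mk' ⟨⟨⟨ρ, key _ _ (by simp)⟩, ?_⟩, key _ _ (by simp), ?_⟩ ?_, hρ⟩
  · intro a b
    apply key
    have e : a * b - algebraMap ℝ A (ρ a * ρ b)
        = (a - algebraMap ℝ A (ρ a)) * b + algebraMap ℝ A (ρ a) * (b - algebraMap ℝ A (ρ b)) := by
      rw [map_mul]; ring
    rw [e]
    exact (Commute.all _ _).isNilpotent_add ((Commute.all _ _).isNilpotent_mul_right (hρ a))
      ((Commute.all _ _).isNilpotent_mul_left (hρ b))
  · intro a b
    apply key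
    have e : a + b - algebraMap ℝ A (ρ a + ρ b)
        = (a - algebraMap ℝ A (ρ a)) + (b - algebraMap ℝ A (ρ b)) := by
      rw [map_add]; ring
    change IsNilpotent (a + b - algebraMap ℝ A (ρ a + ρ b))
    rw [e]
    exact (Commute.all _ _).isNilpotent_add (hρ a) (hρ b)
  · intro c a
    change ρ (c • a) = c • ρ a
    apply key
    have e : c • a - algebraMap ℝ A (c • ρ a)
        = algebraMap ℝ A c * (a - algebraMap ℝ A (ρ a)) := by
      rw [smul_eq_mul, map_mul, Algebra.smul_def]; ring
    rw [e]
    exact (Commute.all _ _).isNilpotent_mul_left (hρ a)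

/-- The real part projection `ρ : A = ℝ ⊕ N → ℝ`. -/
noncomputable def realPart : A →ₐ[ℝ] ℝ := (exists_realPart A).choose

theorem isNilpotent_sub_realPart (a : A) : IsNilpotent (a - algebraMap ℝ A (realPart A a)) :=
  (exists_realPart A).choose_spec a

variable {A} in
theorem realPart_of_isNilpotent {a : A} (h : IsNilpotent a) : realPart A a = 0 :=
  (h.map (realPart A)).eq_zero

theorem exists_generators : ∃ (k : ℕ) (a : Fin k → A),
    (∀ i, IsNilpotent (a i)) ∧ Algebra.adjoin ℝ (Set.range a) = ⊤ := by
  refine ⟨Module.finrank ℝ A, fun i => Module.finBasis ℝ A i -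
    algebraMap ℝ A (realPart A (Module.finBasis ℝ A i)),
    fun i => isNilpotent_sub_realPart A _, ?_⟩
  rw [eq_top_iff]
  intro x _
  rw [← (Module.finBasis ℝ A).sum_repr x]
  refine Subalgebra.sum_mem _ fun i _ => Subalgebra.smul_mem _ ?_ _
  have h := Subalgebra.add_mem _ (Algebra.subset_adjoin (R := ℝ) (Set.mem_range_self i))
    ((Algebra.adjoin ℝ (Set.range fun i => Module.finBasis ℝ A i -
    algebraMap ℝ A (realPart A (Module.finBasis ℝ A i)))).algebraMap_mem
      (realPart A (Module.finBasis ℝ A i)))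
  simpa using h

open Classical in
/-- The width of `A`: the least number of nilpotent elements that generate `A`. -/
noncomputable def width : ℕ := Nat.find (exists_generators A)

open Classical in
/-- A minimal family of nilpotent generators of `A`; it presents `A` as the quotient of the algebra
of germs of smooth functions at `0 ∈ ℝ^k`, `k` the width of `A`, by the kernel of `jet A`. -/
noncomputable def gen : Fin (width A) → A := (Nat.find_spec (exists_generators A)).choose

theorem isNilpotent_gen (i : Fin (width A)) : IsNilpotent (gen A i) := by
  classical exact (Nat.find_spec (exists_generators A)).choose_spec.1 i

theorem adjoin_gen : Algebra.adjoin ℝ (Set.range (gen A)) = ⊤ := by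
  classical exact (Nat.find_spec (exists_generators A)).choose_spec.2

/-- The least `r` with `N ^ r = 0`. -/
noncomputable def nilOrder : ℕ := nilpotencyClass (nilradical A)

theorem nilradical_pow : nilradical A ^ nilOrder A = ⊥ := by
  have : IsNoetherianRing A := IsNoetherianRing.of_finite ℝ A
  exact pow_nilpotencyClass (IsNoetherianRing.isNilpotent_nilradical A)

theorem nilOrder_pos : 0 < nilOrder A := by
  have := WeilAlgebra.nontrivial (A := A)
  by_contra h
  have h1 := nilradical_pow A
  rw [Nat.eq_zero_of_not_pos h, pow_zero, Ideal.one_eq_top] at h1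
  exact top_ne_bot h1

/-- The image in `A = E(k) / I` of (the germ at `0` of) a smooth function `f` on `ℝ^k`: the
Taylor polynomial of `f` at `0`, evaluated at the generators of `A`. -/
noncomputable def jet (f : (Fin (width A) → ℝ) → ℝ) : A :=
  ∑ m ∈ Finset.range (nilOrder A), (m.factorial : ℝ)⁻¹ • ∑ i : Fin m → Fin (width A),
    iteratedFDeriv ℝ m f 0 (fun j => Pi.single (i j) 1) • ∏ j, gen A (i j)

/-- The vector space `T^A E = E ⊗ A` of a vector space `E`, in coordinates with respect to a basis
of `A`. -/
abbrev Model (E : Type*) : Type _ := Fin (Module.finrank ℝ A) → E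

variable {E : Type*} [NormedAddCommGroup E] [NormedSpace ℝ E]

/-- The analogue of `jet` for a function with values in a vector space `E`: an element of `E ⊗ A`,
in coordinates. -/
noncomputable def vjet (g : (Fin (width A) → ℝ) → E) : Model A E := fun c =>
  ∑ m ∈ Finset.range (nilOrder A), (m.factorial : ℝ)⁻¹ • ∑ i : Fin m → Fin (width A),
    (Module.finBasis ℝ A).repr (∏ j, gen A (i j)) c •
      iteratedFDeriv ℝ m g 0 (fun j => Pi.single (i j) 1)

end Algebra

section Jets

theorem coeff_zero_of_isBigO (r : ℕ) : ∀ (P : Polynomial ℝ),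
    ((fun t => P.eval t) =O[𝓝[≠] (0 : ℝ)] fun t => t ^ r) → ∀ m < r, P.coeff m = 0 := by
  induction r with
  | zero => intro P _ m hm; omega
  | succ r ih =>
    intro P h m hm
    have h0 : P.eval 0 = 0 := by
      have t1 : Filter.Tendsto (fun t => P.eval t) (𝓝[≠] (0 : ℝ)) (𝓝 0) := by
        refine h.trans_tendsto ?_
        have : Filter.Tendsto (fun t : ℝ => t ^ (r + 1)) (𝓝 0) (𝓝 (0 ^ (r + 1))) :=
          (continuous_pow (r + 1)).tendsto 0
        simp only [ne_eq, Nat.add_eq_zero_iff, one_ne_zero, and_false, not_false_eq_true, zero_pow]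
          at this
        exact this.mono_left nhdsWithin_le_nhds
      have t2 : Filter.Tendsto (fun t => P.eval t) (𝓝[≠] (0 : ℝ)) (𝓝 (P.eval 0)) :=
        (P.continuous.tendsto 0).mono_left nhdsWithin_le_nhds
      exact tendsto_nhds_unique t2 t1
    obtain ⟨Q, rfl⟩ : Polynomial.X ∣ P := Polynomial.X_dvd_iff.2 (by
      rwa [Polynomial.coeff_zero_eq_eval_zero])
    cases m with
    | zero => simp
    | succ m =>
      rw [Polynomial.coeff_X_mul]
      refine ih Q ?_ m (by omega)
      have h2 := (Asymptotics.isBigO_refl (fun t : ℝ => t⁻¹) (𝓝[≠] (0 : ℝ))).mul h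
      refine (h2.congr' ?_ ?_)
      · filter_upwards [self_mem_nhdsWithin] with t ht
        have : t ≠ 0 := ht
        simp [this]
      · filter_upwards [self_mem_nhdsWithin] with t ht
        have : t ≠ 0 := ht
        field_simp
        ring

theorem eval_smul_of_isHomogeneous {k m : ℕ} {p : MvPolynomial (Fin k) ℝ} (h : p.IsHomogeneous m)
    (t : ℝ) (u : Fin k → ℝ) :
    MvPolynomial.eval (t • u) p = t ^ m * MvPolynomial.eval u p := by
  rw [MvPolynomial.eval_eq, MvPolynomial.eval_eq, Finset.mul_sum]
  refine Finset.sum_congr rfl fun d hd => ?_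
  have hdeg : d.degree = m := by
    have := h (MvPolynomial.mem_support_iff.1 hd)
    rwa [Finsupp.degree_eq_weight_one]
  have : t ^ m = ∏ i ∈ d.support, t ^ d i := by
    rw [Finset.prod_pow_eq_pow_sum, ← hdeg, Finsupp.degree_apply]
  rw [this]
  simp only [Pi.smul_apply, smul_eq_mul, mul_pow, Finset.prod_mul_distrib]
  ring

variable {A : Type*} [CommRing A] [Algebra ℝ A] [WeilAlgebra A]

theorem prod_eq_zero_of_nilOrder_le {ι : Type*} (s : Finset ι) (a : ι → A)
    (h : ∀ j ∈ s, IsNilpotent (a j)) (hm : nilOrder A ≤ s.card) : ∏ j ∈ s, a j = 0 := by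
  have h1 : ∏ j ∈ s, a j ∈ ∏ _j ∈ s, nilradical A :=
    Ideal.prod_mem_prod fun j hj => mem_nilradical.2 (h j hj)
  rw [Finset.prod_const] at h1
  have h2 := Ideal.pow_le_pow_right hm h1
  rw [nilradical_pow] at h2
  exact h2

theorem aeval_eq_zero_of_isBigO {k : ℕ} {n : Fin k → A} (hn : ∀ i, IsNilpotent (n i))
    (q : MvPolynomial (Fin k) ℝ)
    (h : (fun u => MvPolynomial.eval u q) =O[𝓝 0] fun u : Fin k → ℝ => ‖u‖ ^ nilOrder A) :
    MvPolynomial.aeval n q = 0 := by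
  have hom : ∀ m < nilOrder A, MvPolynomial.homogeneousComponent m q = 0 := by
    intro m hm
    apply MvPolynomial.funext
    intro u
    rw [map_zero]
    let P : Polynomial ℝ := ∑ m ∈ Finset.range (q.totalDegree + 1),
      Polynomial.C (MvPolynomial.eval u (MvPolynomial.homogeneousComponent m q)) * Polynomial.X ^ m
    have hP : ∀ t : ℝ, P.eval t = MvPolynomial.eval (t • u) q := by
      intro t
      conv_rhs => rw [← MvPolynomial.sum_homogeneousComponent q]
      simp only [P, Polynomial.eval_finsetSum, map_sum]
      refine Finset.sum_congr rfl fun m _ => ?_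
      rw [eval_smul_of_isHomogeneous (MvPolynomial.homogeneousComponent_isHomogeneous m q)]
      simp only [Polynomial.eval_mul, Polynomial.eval_C, Polynomial.eval_pow, Polynomial.eval_X]
      exact mul_comm _ _
    have hb : (fun t => P.eval t) =O[𝓝[≠] (0 : ℝ)] fun t => t ^ nilOrder A := by
      have tt : Filter.Tendsto (fun t : ℝ => t • u) (𝓝[≠] 0) (𝓝 0) := by
        have : Filter.Tendsto (fun t : ℝ => t • u) (𝓝 0) (𝓝 ((0 : ℝ) • u)) :=
          (continuous_id.smul continuous_const).tendsto 0
        rw [zero_smul] at this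
        exact this.mono_left nhdsWithin_le_nhds
      simp only [hP]
      refine (h.comp_tendsto tt).trans ?_
      refine Asymptotics.IsBigO.of_bound (‖u‖ ^ nilOrder A) (Filter.Eventually.of_forall ?_)
      intro t
      simp [norm_smul, mul_pow, mul_comm]
    have hc := coeff_zero_of_isBigO _ P hb m hm
    by_cases hq : m < q.totalDegree + 1
    · simpa [P, Polynomial.finsetSum_coeff, Polynomial.coeff_X_pow, hq] using hc
    · rw [MvPolynomial.homogeneousComponent_eq_zero _ _ (by omega), map_zero]
  rw [← MvPolynomial.sum_homogeneousComponent q, map_sum]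
  refine Finset.sum_eq_zero fun m _ => ?_
  by_cases hm : m < nilOrder A
  · rw [hom m hm, map_zero]
  · rw [MvPolynomial.aeval_def, MvPolynomial.eval₂_eq]
    refine Finset.sum_eq_zero fun d hd => ?_
    have hdeg : d.degree = m := by
      have := MvPolynomial.homogeneousComponent_isHomogeneous m q (MvPolynomial.mem_support_iff.1 hd)
      rwa [Finsupp.degree_eq_weight_one]
    have : ∏ i ∈ d.support, n i ^ d i = 0 := by
      have e : ∏ i ∈ d.support, n i ^ d i =
          ∏ x ∈ d.support.sigma fun i => (Finset.univ : Finset (Fin (d i))), n x.1 := by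
        rw [Finset.prod_sigma]; simp
      rw [e]
      apply prod_eq_zero_of_nilOrder_le
      · intro j _; exact hn _
      · rw [Finset.card_sigma]
        simp only [Finset.card_univ, Fintype.card_fin]
        change nilOrder A ≤ d.degree
        omega
    rw [this, mul_zero]

end Jets

section Taylor

theorem taylor_isBigO {E G : Type*} [NormedAddCommGroup E] [NormedSpace ℝ E]
    [NormedAddCommGroup G] [NormedSpace ℝ G] [CompleteSpace G] {F : E → G} {x : E} {r : ℕ}
    (hr : 0 < r) (hF : ContDiffAt ℝ r F x) :
    (fun y => F y - ∑ m ∈ Finset.range r, (m.factorial : ℝ)⁻¹ • iteratedFDeriv ℝ m F x (fun _ => y - x))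
      =O[𝓝 x] fun y => ‖y - x‖ ^ r := by
  obtain ⟨n, rfl⟩ : ∃ n, r = n + 1 := ⟨r - 1, by omega⟩
  have h1 : ∀ᶠ y in 𝓝 x, ContDiffAt ℝ ((n + 1 : ℕ) : WithTop ℕ∞) F y :=
    hF.eventually (by simp)
  have hc : ContinuousAt (iteratedFDeriv ℝ (n + 1) F) x := hF.continuousAt_iteratedFDeriv le_rfl
  have h2 : ∀ᶠ y in 𝓝 x, ‖iteratedFDeriv ℝ (n + 1) F y‖ ≤ ‖iteratedFDeriv ℝ (n + 1) F x‖ + 1 := by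
    filter_upwards [hc.norm.eventually (gt_mem_nhds (lt_add_one _))] with y hy using hy.le
  set C := ‖iteratedFDeriv ℝ (n + 1) F x‖ + 1 with hC
  obtain ⟨ε, hε, hb⟩ := Metric.eventually_nhds_iff_ball.1 (h1.and h2)
  refine Asymptotics.IsBigO.of_bound ((n.factorial : ℝ)⁻¹ * C) ?_
  filter_upwards [Metric.ball_mem_nhds x hε] with y hy
  have hmem : ∀ t ∈ Set.Icc (0 : ℝ) 1, x + t • (y - x) ∈ Metric.ball x ε := by
    intro t ht
    rw [mem_ball_iff_norm] at hy ⊢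
    rw [add_sub_cancel_left, norm_smul, Real.norm_of_nonneg ht.1]
    exact (mul_le_of_le_one_left (norm_nonneg _) ht.2).trans_lt hy
  have key := map_add_eq_sum_add_integral_iteratedFDeriv (f := F) (x := x) (y := y - x) (n := n)
    (fun t ht => by exact_mod_cast (hb _ (hmem t ht)).1)
  rw [add_sub_cancel] at key
  rw [key, add_sub_cancel_left, norm_smul, norm_inv, Real.norm_natCast, norm_pow, norm_norm,
    mul_assoc]
  gcongr
  have := intervalIntegral.norm_integral_le_of_norm_le_const (a := (0 : ℝ)) (b := 1)
    (C := C * ‖y - x‖ ^ (n + 1))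
    (f := fun t => (1 - t) ^ n • iteratedFDeriv ℝ (n + 1) F (x + t • (y - x)) fun _ => y - x) ?_
  · simpa using this
  · intro t ht
    rw [Set.uIoc_of_le zero_le_one] at ht
    have ht' : t ∈ Set.Icc (0 : ℝ) 1 := ⟨ht.1.le, ht.2⟩
    rw [norm_smul, norm_pow, Real.norm_of_nonneg (by linarith [ht'.2])]
    have hp : (1 - t) ^ n ≤ 1 := pow_le_one₀ (by linarith [ht'.2]) (by linarith [ht'.1])
    have h3 : ‖iteratedFDeriv ℝ (n + 1) F (x + t • (y - x)) fun _ => y - x‖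
        ≤ C * ‖y - x‖ ^ (n + 1) := by
      refine (ContinuousMultilinearMap.le_opNorm _ _).trans ?_
      rw [Finset.prod_const, Finset.card_univ, Fintype.card_fin]
      gcongr
      exact (hb _ (hmem t ht')).2
    calc (1 - t) ^ n * _ ≤ 1 * _ := by gcongr
      _ = _ := one_mul _
      _ ≤ _ := h3

variable {A : Type*} [CommRing A] [Algebra ℝ A] [WeilAlgebra A]
variable {G : Type*} [NormedAddCommGroup G] [NormedSpace ℝ G]

theorem isBigO_unique {k : ℕ} {n : Fin k → A} (hn : ∀ i, IsNilpotent (n i))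
    {σ : Type*} (s : Finset σ) (p : σ → MvPolynomial (Fin k) ℝ) (y : σ → G)
    (h : (fun u => ∑ i ∈ s, MvPolynomial.eval u (p i) • y i) =O[𝓝 0]
      fun u : Fin k → ℝ => ‖u‖ ^ nilOrder A) (c : Fin (Module.finrank ℝ A)) :
    ∑ i ∈ s, (Module.finBasis ℝ A).repr (MvPolynomial.aeval n (p i)) c • y i = 0 := by
  refine SeparatingDual.eq_zero_of_forall_dual_eq_zero (R := ℝ) fun f => ?_
  have h1 : MvPolynomial.aeval n (∑ i ∈ s, f (y i) • p i) = 0 := by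
    refine aeval_eq_zero_of_isBigO hn _ ?_
    refine (((f.isBigO_comp (fun u => ∑ i ∈ s, MvPolynomial.eval u (p i) • y i) (𝓝 0)).trans
      h).congr_left ?_)
    intro u
    simp [MvPolynomial.smul_eval, mul_comm]
  rw [map_sum] at h1
  have h2 := congrArg (fun a => (Module.finBasis ℝ A).repr a c) h1
  simp only [map_sum, map_smul, Finsupp.coe_finsetSum, Finset.sum_apply, map_zero,
    Finsupp.smul_apply, Finsupp.zero_apply, smul_eq_mul] at h2
  simp only [map_sum, map_smul, smul_eq_mul]
  rw [← h2]
  exact Finset.sum_congr rfl fun i _ => mul_comm _ _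

theorem multilinear_expand {k m : ℕ} (L : ContinuousMultilinearMap ℝ (fun _ : Fin m => Fin k → ℝ) G)
    (u : Fin k → ℝ) : L (fun _ => u) =
      ∑ i : Fin m → Fin k, (∏ j, u (i j)) • L (fun j => Pi.single (i j) 1) := by
  conv_lhs => rw [pi_eq_sum_univ' u]
  rw [L.map_sum]
  refine Finset.sum_congr rfl fun i _ => ?_
  rw [L.map_smul_univ]

/-- If `g` is a sum `∑ pᵢ yᵢ` with polynomials `pᵢ`, up to terms of order `nilOrder A`, then the
`A`-jet of `g` is `∑ yᵢ ⊗ pᵢ(gen)`. -/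
theorem vjet_eq [CompleteSpace G] {g : (Fin (width A) → ℝ) → G}
    (hg : ContDiffAt ℝ (nilOrder A) g 0)
    {σ : Type*} (s : Finset σ) (p : σ → MvPolynomial (Fin (width A)) ℝ) (y : σ → G)
    (h : (fun u => g u - ∑ i ∈ s, MvPolynomial.eval u (p i) • y i) =O[𝓝 0]
      fun u : Fin (width A) → ℝ => ‖u‖ ^ nilOrder A) :
    vjet A g = fun c =>
      ∑ i ∈ s, (Module.finBasis ℝ A).repr (MvPolynomial.aeval (gen A) (p i)) c • y i := by
  have ht := taylor_isBigO (nilOrder_pos A) hg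
  simp only [sub_zero] at ht
  let T : Finset (Σ m : ℕ, (Fin m → Fin (width A))) :=
    (Finset.range (nilOrder A)).sigma fun m => Finset.univ
  let P : (Σ m : ℕ, (Fin m → Fin (width A))) → MvPolynomial (Fin (width A)) ℝ :=
    fun a => (a.1.factorial : ℝ)⁻¹ • ∏ j, MvPolynomial.X (a.2 j)
  let Y : (Σ m : ℕ, (Fin m → Fin (width A))) → G :=
    fun a => iteratedFDeriv ℝ a.1 g 0 (fun j => Pi.single (a.2 j) 1)
  have hT : ∀ u, ∑ a ∈ T, MvPolynomial.eval u (P a) • Y a =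
      ∑ m ∈ Finset.range (nilOrder A), (m.factorial : ℝ)⁻¹ • iteratedFDeriv ℝ m g 0 (fun _ => u) := by
    intro u
    rw [Finset.sum_sigma]
    refine Finset.sum_congr rfl fun m _ => ?_
    rw [multilinear_expand, Finset.smul_sum]
    refine Finset.sum_congr rfl fun i _ => ?_
    simp [P, Y, MvPolynomial.smul_eval, map_prod, mul_smul]
  have hd : (fun u => ∑ a ∈ T.disjSum s, MvPolynomial.eval u (Sum.elim P p a) •
      Sum.elim Y (fun i => - y i) a) =O[𝓝 0]
      fun u : Fin (width A) → ℝ => ‖u‖ ^ nilOrder A := by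
    refine (h.sub ht).congr_left fun u => ?_
    rw [Finset.sum_disjSum]
    simp only [Sum.elim_inl, Sum.elim_inr, hT, smul_neg, Finset.sum_neg_distrib]
    abel
  funext c
  have h3 := isBigO_unique (isNilpotent_gen A) _ _ _ hd c
  rw [Finset.sum_disjSum] at h3
  simp only [Sum.elim_inl, Sum.elim_inr, smul_neg, Finset.sum_neg_distrib] at h3
  rw [← sub_eq_add_neg, sub_eq_zero] at h3
  rw [← h3, vjet, Finset.sum_sigma]
  refine Finset.sum_congr rfl fun m _ => ?_
  rw [Finset.smul_sum]
  refine Finset.sum_congr rfl fun i _ => ?_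
  simp [P, Y, map_prod, mul_smul]

/-- Every smooth function is polynomial up to terms of order `r`. -/
theorem exists_poly [CompleteSpace G] {k r : ℕ} (hr : 0 < r) {g : (Fin k → ℝ) → G}
    (hg : ContDiffAt ℝ r g 0) :
    ∃ (s : Finset (Σ m : ℕ, (Fin m → Fin k))) (p : _ → MvPolynomial (Fin k) ℝ) (y : _ → G),
    (fun u => g u - ∑ i ∈ s, MvPolynomial.eval u (p i) • y i) =O[𝓝 0]
      fun u : Fin k → ℝ => ‖u‖ ^ r := by
  have ht := taylor_isBigO hr hg
  simp only [sub_zero] at ht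
  refine ⟨(Finset.range r).sigma fun m => Finset.univ,
    fun a => (a.1.factorial : ℝ)⁻¹ • ∏ j, MvPolynomial.X (a.2 j),
    fun a => iteratedFDeriv ℝ a.1 g 0 (fun j => Pi.single (a.2 j) 1), ?_⟩
  refine ht.congr_left fun u => ?_
  rw [Finset.sum_sigma]
  congr 1
  refine Finset.sum_congr rfl fun m _ => ?_
  rw [multilinear_expand, Finset.smul_sum]
  refine Finset.sum_congr rfl fun i _ => ?_
  simp [MvPolynomial.smul_eval, map_prod, mul_smul]

end Taylor

section TaylorMap

variable (A : Type*) [CommRing A] [Algebra ℝ A] [WeilAlgebra A]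
variable {E : Type*} [NormedAddCommGroup E] [NormedSpace ℝ E]
variable {G : Type*} [NormedAddCommGroup G] [NormedSpace ℝ G]

/-- The nilpotent part of the `c`-th element of the basis of `A`. -/
noncomputable def nilBasis (c : Fin (Module.finrank ℝ A)) : A :=
  Module.finBasis ℝ A c - algebraMap ℝ A (realPart A (Module.finBasis ℝ A c))

/-- The projection `id ⊗ ρ : E ⊗ A → E`. -/
noncomputable def base (v : Model A E) : E := ∑ c, realPart A (Module.finBasis ℝ A c) • v c

/-- The map `T^A F : E ⊗ A → G ⊗ A` in coordinates:
`T^A F (x + n) = ∑ D^m F (x) (n, …, n) / m!` for `x ∈ E` and nilpotent `n ∈ E ⊗ N`. -/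
noncomputable def taylorMap (F : E → G) (v : Model A E) : Model A G := fun e =>
  ∑ m ∈ Finset.range (nilOrder A), (m.factorial : ℝ)⁻¹ • ∑ c : Fin m → Fin (Module.finrank ℝ A),
    (Module.finBasis ℝ A).repr (∏ j, nilBasis A (c j)) e •
      iteratedFDeriv ℝ m F (base A v) (fun j => v (c j))

variable {A}

theorem sum_repr_nilBasis (a : A) :
    ∑ c, (Module.finBasis ℝ A).repr a c • nilBasis A c = a - algebraMap ℝ A (realPart A a) := by
  conv_rhs => rw [← (Module.finBasis ℝ A).sum_repr a]
  simp only [nilBasis, smul_sub, Finset.sum_sub_distrib, map_sum, map_smul]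
  congr 1
  refine Finset.sum_congr rfl fun i _ => ?_
  rw [smul_eq_mul, map_mul, Algebra.smul_def]

theorem realPart_aeval (p : MvPolynomial (Fin (width A)) ℝ) :
    realPart A (MvPolynomial.aeval (gen A) p) = MvPolynomial.eval 0 p := by
  rw [← AlgHom.comp_apply, MvPolynomial.comp_aeval]
  have : (fun i => realPart A (gen A i)) = 0 := by
    funext i; exact realPart_of_isNilpotent (isNilpotent_gen A i)
  rw [this]
  simp [MvPolynomial.aeval_def, MvPolynomial.eval]

theorem base_sum {σ : Type*} (s : Finset σ) (a : σ → A) (y : σ → E) :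
    base A (fun c => ∑ i ∈ s, (Module.finBasis ℝ A).repr (a i) c • y i) =
      ∑ i ∈ s, realPart A (a i) • y i := by
  simp only [base, Finset.smul_sum]
  rw [Finset.sum_comm]
  refine Finset.sum_congr rfl fun i _ => ?_
  conv_rhs => rw [← (Module.finBasis ℝ A).sum_repr (a i)]
  simp only [map_sum, map_smul, smul_smul, ← Finset.sum_smul]
  congr 1
  exact Finset.sum_congr rfl fun c _ => mul_comm _ _

theorem taylorMap_sum (F : E → G) {σ : Type*} [DecidableEq σ] (s : Finset σ) (a : σ → A)
    (y : σ → E) (e : Fin (Module.finrank ℝ A)) :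
    taylorMap A F (fun c => ∑ i ∈ s, (Module.finBasis ℝ A).repr (a i) c • y i) e =
      ∑ m ∈ Finset.range (nilOrder A), (m.factorial : ℝ)⁻¹ • ∑ i ∈ Fintype.piFinset fun _ : Fin m => s,
        (Module.finBasis ℝ A).repr (∏ j, (a (i j) - algebraMap ℝ A (realPart A (a (i j))))) e •
        iteratedFDeriv ℝ m F (∑ i ∈ s, realPart A (a i) • y i) (fun j => y (i j)) := by
  unfold taylorMap
  rw [base_sum]
  refine Finset.sum_congr rfl fun m _ => ?_
  congr 1
  set L := iteratedFDeriv ℝ m F (∑ i ∈ s, realPart A (a i) • y i)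
  have h1 : ∀ c : Fin m → Fin (Module.finrank ℝ A),
      L (fun j => ∑ i ∈ s, (Module.finBasis ℝ A).repr (a i) (c j) • y i) =
      ∑ i ∈ Fintype.piFinset fun _ : Fin m => s,
        (∏ j, (Module.finBasis ℝ A).repr (a (i j)) (c j)) • L (fun j => y (i j)) := by
    intro c
    have := L.toMultilinearMap.map_sum_finset
      (fun (j : Fin m) (i : σ) => (Module.finBasis ℝ A).repr (a i) (c j) • y i) (fun _ => s)
    refine this.trans ?_
    refine Finset.sum_congr rfl fun i _ => ?_
    exact L.toMultilinearMap.map_smul_univ (fun j => (Module.finBasis ℝ A).repr (a (i j)) (c j))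
      (fun j => y (i j))
  simp only [h1, Finset.smul_sum]
  rw [Finset.sum_comm]
  refine Finset.sum_congr rfl fun i _ => ?_
  simp only [smul_smul, ← Finset.sum_smul]
  congr 1
  simp only [← sum_repr_nilBasis]
  rw [Finset.prod_univ_sum, map_sum, Finsupp.coe_finsetSum, Finset.sum_apply]
  simp only [Fintype.piFinset_univ]
  refine Finset.sum_congr rfl fun c _ => ?_
  rw [Finset.prod_smul, map_smul, Finsupp.smul_apply, smul_eq_mul, mul_comm]

theorem contDiff_eval {k : ℕ} (p : MvPolynomial (Fin k) ℝ) :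
    ContDiff ℝ ∞ fun u : Fin k → ℝ => MvPolynomial.eval u p :=
  (AnalyticOnNhd.eval_mvPolynomial p).contDiff

theorem vjet_comp [CompleteSpace E] [CompleteSpace G] {F : E → G} {γ : (Fin (width A) → ℝ) → E}
    (hF : ContDiffAt ℝ (nilOrder A) F (γ 0)) (hγ : ContDiffAt ℝ (nilOrder A) γ 0) :
    base A (vjet A γ) = γ 0 ∧ vjet A (fun u => F (γ u)) = taylorMap A F (vjet A γ) := by
  classical
  obtain ⟨s, p, y, h⟩ := exists_poly (nilOrder_pos A) hγ
  have hr := nilOrder_pos A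
  have hr1 : (1 : WithTop ℕ∞) ≤ (nilOrder A : ℕ) := by exact_mod_cast hr
  rw [vjet_eq hγ s p y h]
  set P : (Fin (width A) → ℝ) → E := fun u => ∑ i ∈ s, MvPolynomial.eval u (p i) • y i with hP
  have hP0 : P 0 = γ 0 := by
    have h0 : (fun u => γ u - P u) =O[𝓝 0] fun u : Fin (width A) → ℝ => ‖u - 0‖ ^ nilOrder A := by
      simpa using h
    have := h0.eq_zero_of_norm_pow hr.ne'
    exact (sub_eq_zero.1 this).symm
  have hx : ∑ i ∈ s, realPart A (MvPolynomial.aeval (gen A) (p i)) • y i = γ 0 := by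
    rw [← hP0]; simp only [hP, realPart_aeval]
  refine ⟨by rw [base_sum, hx], ?_⟩
  have hPd : ContDiff ℝ ∞ P := by
    exact ContDiff.sum fun i _ => ContDiff.smul (contDiff_eval (p i)) contDiff_const
  let q : _ → MvPolynomial (Fin (width A)) ℝ := fun i => p i - MvPolynomial.C (MvPolynomial.eval 0 (p i))
  have hPq : ∀ u, P u - γ 0 = ∑ i ∈ s, MvPolynomial.eval u (q i) • y i := by
    intro u
    rw [← hP0]
    simp [hP, q, sub_smul]
  have e1 : (fun u => F (γ u) - F (P u)) =O[𝓝 0] fun u : Fin (width A) → ℝ => ‖u‖ ^ nilOrder A := by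
    have hs := ((hF.of_le hr1).hasStrictFDerivAt one_ne_zero).isBigO_sub
    have tt : Filter.Tendsto (fun u => (γ u, P u)) (𝓝 0) (𝓝 (γ 0, γ 0)) := by
      refine Filter.Tendsto.prodMk_nhds hγ.continuousAt ?_
      rw [← hP0]; exact hPd.continuous.continuousAt
    exact (hs.comp_tendsto tt).trans h
  have e2 : (fun u => F (P u) - ∑ m ∈ Finset.range (nilOrder A),
      (m.factorial : ℝ)⁻¹ • iteratedFDeriv ℝ m F (γ 0) (fun _ => P u - γ 0))
      =O[𝓝 0] fun u : Fin (width A) → ℝ => ‖u‖ ^ nilOrder A := by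
    have tt : Filter.Tendsto P (𝓝 0) (𝓝 (γ 0)) := by
      rw [← hP0]; exact hPd.continuous.continuousAt
    refine ((taylor_isBigO hr hF).comp_tendsto tt).trans ?_
    have := ((hPd.contDiffAt (x := 0)).differentiableAt (by simp)).isBigO_sub
    rw [hP0] at this
    simp only [sub_zero] at this
    exact (this.norm_norm.pow _)
  let S : Finset (Σ m : ℕ, (Fin m → Σ m : ℕ, (Fin m → Fin (width A)))) :=
    (Finset.range (nilOrder A)).sigma fun m => Fintype.piFinset fun _ : Fin m => s
  rw [show (fun u => F (γ u)) = F ∘ γ from rfl, vjet_eq (hF.comp (0 : Fin (width A) → ℝ) hγ) S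
    (fun a => (a.1.factorial : ℝ)⁻¹ • ∏ j, q (a.2 j))
    (fun a => iteratedFDeriv ℝ a.1 F (γ 0) (fun j => y (a.2 j)))]
  · funext c
    rw [taylorMap_sum, Finset.sum_sigma, hx]
    refine Finset.sum_congr rfl fun m _ => ?_
    rw [Finset.smul_sum]
    refine Finset.sum_congr rfl fun i _ => ?_
    simp [q, map_prod, realPart_aeval, mul_smul]
  · refine (e1.add e2).congr_left fun u => ?_
    rw [sub_add_sub_cancel]
    congr 1
    rw [Finset.sum_sigma]
    refine Finset.sum_congr rfl fun m _ => ?_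
    simp only [hPq]
    have := (iteratedFDeriv ℝ m F (γ 0)).toMultilinearMap.map_sum_finset
      (fun (j : Fin m) i => MvPolynomial.eval u (q i) • y i) (fun _ => s)
    rw [show (iteratedFDeriv ℝ m F (γ 0)) (fun _ => ∑ i ∈ s, MvPolynomial.eval u (q i) • y i) = _
      from this, Finset.smul_sum]
    refine Finset.sum_congr rfl fun i _ => ?_
    have h2 := (iteratedFDeriv ℝ m F (γ 0)).toMultilinearMap.map_smul_univ
      (fun j => MvPolynomial.eval u (q (i j))) (fun j => y (i j))
    rw [h2, MvPolynomial.smul_eval, map_prod, mul_smul]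
    rfl

variable (A) in
theorem exists_section : ∃ q : Fin (Module.finrank ℝ A) → (Fin (width A) → ℝ) → ℝ,
    (∀ c, ContDiff ℝ ∞ (q c)) ∧ ∀ (E : Type _) [NormedAddCommGroup E] [NormedSpace ℝ E]
      [CompleteSpace E] (v : Model A E),
      ∑ c, q c 0 • v c = base A v ∧ vjet A (fun u => ∑ c, q c u • v c) = v := by
  have hq : ∀ c, ∃ q : MvPolynomial (Fin (width A)) ℝ,
      MvPolynomial.aeval (gen A) q = Module.finBasis ℝ A c := by
    intro c
    have h : Module.finBasis ℝ A c ∈ Algebra.adjoin ℝ (Set.range (gen A)) := by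
      rw [adjoin_gen]; trivial
    rw [Algebra.adjoin_range_eq_range_aeval] at h
    exact h
  choose q hq using hq
  refine ⟨fun c u => MvPolynomial.eval u (q c), fun c => contDiff_eval (q c), ?_⟩
  intro E _ _ _ v
  have hγ : ContDiff ℝ ∞ fun u => ∑ c, MvPolynomial.eval u (q c) • v c :=
    ContDiff.sum fun i _ => (contDiff_eval (q i)).smul contDiff_const
  refine ⟨?_, ?_⟩
  · simp only [base, ← hq, realPart_aeval]
  · rw [vjet_eq ((hγ.of_le (by exact_mod_cast le_top)).contDiffAt) Finset.univ q v
      (by simpa using Asymptotics.isBigO_zero _ _)]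
    funext c
    simp only [hq, Module.Basis.repr_self, Finsupp.single_apply]
    simp

theorem exists_vjet_eq [CompleteSpace E] (v : Model A E) : ∃ γ : (Fin (width A) → ℝ) → E,
    ContDiff ℝ ∞ γ ∧ γ 0 = base A v ∧ vjet A γ = v := by
  obtain ⟨q, hq, h⟩ := exists_section A
  exact ⟨fun u => ∑ c, q c u • v c, ContDiff.sum fun i _ => (hq i).smul contDiff_const,
    (h E v).1, (h E v).2⟩

theorem vjet_congr {γ γ' : (Fin (width A) → ℝ) → E} (h : γ =ᶠ[𝓝 0] γ') :
    vjet A γ = vjet A γ' := by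
  funext c
  simp only [vjet]
  refine Finset.sum_congr rfl fun m _ => ?_
  congr 1
  refine Finset.sum_congr rfl fun i _ => ?_
  rw [(h.iteratedFDeriv ℝ m).eq_of_nhds]

theorem vjet_clm {γ : (Fin (width A) → ℝ) → E} (hγ : ContDiffAt ℝ ∞ γ 0)
    (L : E →L[ℝ] G) (c : Fin (Module.finrank ℝ A)) :
    vjet A (fun u => L (γ u)) c = L (vjet A γ c) := by
  simp only [vjet, map_sum, map_smul]
  refine Finset.sum_congr rfl fun m _ => ?_
  congr 1
  refine Finset.sum_congr rfl fun i _ => ?_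
  congr 1
  have := L.iteratedFDeriv_comp_left (f := γ) (x := 0) (i := m) hγ (by exact_mod_cast le_top)
  rw [show (fun u => L (γ u)) = L ∘ γ from rfl, this]
  rfl

theorem jet_eq (f : (Fin (width A) → ℝ) → ℝ) :
    jet A f = (Module.finBasis ℝ A).equivFun.symm (vjet A f) := by
  apply (Module.finBasis ℝ A).equivFun.injective
  rw [LinearEquiv.apply_symm_apply]
  funext c
  simp [jet, vjet, mul_comm]

theorem taylorMap_congr {F F' : E → G} {v : Model A E} (h : F =ᶠ[𝓝 (base A v)] F') :
    taylorMap A F v = taylorMap A F' v := by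
  funext e
  simp only [taylorMap]
  refine Finset.sum_congr rfl fun m _ => ?_
  congr 1
  refine Finset.sum_congr rfl fun i _ => ?_
  rw [(h.iteratedFDeriv ℝ m).eq_of_nhds]

theorem contDiff_base : ContDiff ℝ ∞ (base A : Model A E → E) := by
  unfold base
  exact ContDiff.sum fun c _ => contDiff_const.smul (contDiff_apply ℝ E c)

theorem contDiffAt_taylorMap [CompleteSpace G] {F : E → G} {v : Model A E} (hF : ContDiffAt ℝ ∞ F (base A v)) :
    ContDiffAt ℝ ∞ (taylorMap A F) v := by
  rw [contDiffAt_pi]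
  intro e
  refine ContDiffAt.sum fun m _ => contDiffAt_const.smul (ContDiffAt.sum fun c _ =>
    contDiffAt_const.smul ?_)
  have h1 : ContDiffAt ℝ ∞ (fun v : Model A E => iteratedFDeriv ℝ m F (base A v)) v :=
    (hF.iteratedFDeriv_right (m := ∞) (i := m) (by exact_mod_cast le_top)).comp v contDiff_base.contDiffAt
  have h2 : ContDiffAt ℝ ∞ (fun v : Model A E => fun j => v (c j)) v :=
    contDiffAt_pi.2 fun j => contDiffAt_apply ..
  have h3 := ((ContinuousLinearMap.id ℝ
    (ContinuousMultilinearMap ℝ (fun _ : Fin m => E) G)).analyticOnNhd_uncurry_of_multilinear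
    (iteratedFDeriv ℝ m F (base A v), fun j => v (c j)) (Set.mem_univ _)).contDiffAt (n := ∞)
  exact h3.comp v (h1.prodMk h2)

end TaylorMap

section Bundle

variable (A : Type*) [CommRing A] [Algebra ℝ A] [WeilAlgebra A]
variable (E : Type*) [NormedAddCommGroup E] [NormedSpace ℝ E]
variable (M : Type*) [TopologicalSpace M] [ChartedSpace E M]

/-- Smooth maps `ℝ^k → M`, `k` the width of `A`. -/
abbrev Plot : Type _ := C^∞⟮𝓘(ℝ, Fin (width A) → ℝ), Fin (width A) → ℝ; 𝓘(ℝ, E), M⟯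

/-- Two smooth maps `g, h : ℝ^k → M` determine the same `A`-velocity if `g 0 = h 0` and, for all
(germs of) smooth functions `f` at this point, `f ∘ g` and `f ∘ h` have the same image in `A`. -/
noncomputable def velocitySetoid : Setoid (Plot A E M) where
  r g h := g 0 = h 0 ∧ ∀ f : M → ℝ, ContMDiffAt 𝓘(ℝ, E) 𝓘(ℝ, ℝ) ∞ f (g 0) →
    jet A (fun u => f (g u)) = jet A (fun u => f (h u))
  iseqv :=
    { refl := fun _ => ⟨rfl, fun _ _ => rfl⟩
      symm := fun h => ⟨h.1.symm, fun f hf => (h.2 f (h.1 ▸ hf)).symm⟩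
      trans := fun h h' => ⟨h.1.trans h'.1, fun f hf => (h.2 f hf).trans (h'.2 f (h.1 ▸ hf))⟩ }

/-- The Weil bundle `T^A M`: the set of all `A`-velocities of smooth maps `ℝ^k → M`. The manifold
`M` is modelled on the vector space `E`. -/
def WeilBundle : Type _ := Quotient (velocitySetoid A E M)

variable {E M}

/-- The `A`-velocity `j^A g`. -/
noncomputable def velocity (g : Plot A E M) : WeilBundle A E M := Quotient.mk _ g

variable (E M)

/-- The bundle projection `p^A_M : T^A M → M`, `j^A g ↦ g 0`. -/
noncomputable def proj : WeilBundle A E M → M := Quotient.lift (fun g : Plot A E M => g 0) fun _ _ h => h.1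

variable {A E M}

theorem velocity_out (z : WeilBundle A E M) : velocity A (Quotient.out z) = z := Quotient.out_eq z

theorem velocity_eq_iff {g h : Plot A E M} : velocity A g = velocity A h ↔ g 0 = h 0 ∧
    ∀ f : M → ℝ, ContMDiffAt 𝓘(ℝ, E) 𝓘(ℝ, ℝ) ∞ f (g 0) →
      jet A (fun u => f (g u)) = jet A (fun u => f (h u)) :=
  Quotient.eq

/-- The map `T^A e : T^A M → T^A E = E ⊗ A` induced by a chart `e` of `M`; it is independent of the
choice of the representative on the fibres over the domain of `e`. -/
noncomputable def chartMap (e : OpenPartialHomeomorph M E) (z : WeilBundle A E M) : Model A E :=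
  vjet A (fun u => e ((Quotient.out z : Plot A E M) u))

variable [IsManifold 𝓘(ℝ, E) ∞ M]
variable {G : Type*} [NormedAddCommGroup G] [NormedSpace ℝ G]

theorem contDiffAt_plot {e : OpenPartialHomeomorph M E} (he : e ∈ atlas E M) (g : Plot A E M)
    (hg : g 0 ∈ e.source) : ContDiffAt ℝ ∞ (fun u => e (g u)) 0 := by
  have h1 : ContMDiffAt 𝓘(ℝ, E) 𝓘(ℝ, E) ∞ e (g 0) :=
    contMDiffAt_of_mem_maximalAtlas (IsManifold.subset_maximalAtlas he) hg
  exact (h1.comp 0 g.contMDiff.contMDiffAt).contDiffAt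

theorem contDiffAt_symm {e : OpenPartialHomeomorph M E} (he : e ∈ atlas E M) {x : M}
    (hx : x ∈ e.source) {f : M → G} (hf : ContMDiffAt 𝓘(ℝ, E) 𝓘(ℝ, G) ∞ f x) :
    ContDiffAt ℝ ∞ (fun y => f (e.symm y)) (e x) := by
  have h1 : ContMDiffAt 𝓘(ℝ, E) 𝓘(ℝ, E) ∞ e.symm (e x) :=
    contMDiffAt_symm_of_mem_maximalAtlas (IsManifold.subset_maximalAtlas he) (e.map_source hx)
  rw [← e.left_inv hx] at hf
  exact (hf.comp _ h1).contDiffAt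

variable [FiniteDimensional ℝ E] [FiniteDimensional ℝ G]

theorem vjet_plot_of_contDiffAt {e : OpenPartialHomeomorph M E} (he : e ∈ atlas E M)
    (g : Plot A E M) (hg : g 0 ∈ e.source) {f : M → G}
    (hf : ContDiffAt ℝ (nilOrder A) (fun y => f (e.symm y)) (e (g 0))) :
    vjet A (fun u => f (g u)) =
      taylorMap A (fun y => f (e.symm y)) (vjet A fun u => e (g u)) := by
  have := FiniteDimensional.complete ℝ E
  have := FiniteDimensional.complete ℝ G
  rw [← (vjet_comp (F := fun y => f (e.symm y)) (γ := fun u => e (g u)) hf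
    ((contDiffAt_plot he g hg).of_le (by exact_mod_cast le_top))).2]
  apply vjet_congr
  filter_upwards [g.contMDiff.continuous.continuousAt.preimage_mem_nhds
    (e.open_source.mem_nhds hg)] with u hu
  rw [e.left_inv hu]

theorem vjet_plot {e : OpenPartialHomeomorph M E} (he : e ∈ atlas E M) (g : Plot A E M)
    (hg : g 0 ∈ e.source) {f : M → G} (hf : ContMDiffAt 𝓘(ℝ, E) 𝓘(ℝ, G) ∞ f (g 0)) :
    vjet A (fun u => f (g u)) =
      taylorMap A (fun y => f (e.symm y)) (vjet A fun u => e (g u)) :=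
  vjet_plot_of_contDiffAt he g hg ((contDiffAt_symm he hg hf).of_le (by exact_mod_cast le_top))

theorem base_vjet_plot {e : OpenPartialHomeomorph M E} (he : e ∈ atlas E M) (g : Plot A E M)
    (hg : g 0 ∈ e.source) : base A (vjet A fun u => e (g u)) = e (g 0) := by
  have := FiniteDimensional.complete ℝ E
  exact (vjet_comp (F := fun _ : E => (0 : ℝ)) (γ := fun u => e (g u)) contDiffAt_const
    ((contDiffAt_plot he g hg).of_le (by exact_mod_cast le_top))).1

theorem velocity_eq_of_vjet {e : OpenPartialHomeomorph M E} (he : e ∈ atlas E M) {g h : Plot A E M}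
    (hg : g 0 ∈ e.source) (hh : h 0 ∈ e.source)
    (H : (vjet A fun u => e (g u)) = vjet A fun u => e (h u)) : velocity A g = velocity A h := by
  have h0 : g 0 = h 0 := by
    apply e.injOn hg hh
    rw [← base_vjet_plot he g hg, ← base_vjet_plot he h hh, H]
  refine velocity_eq_iff.2 ⟨h0, fun f hf => ?_⟩
  rw [jet_eq, jet_eq, vjet_plot he g hg hf, vjet_plot he h hh (h0 ▸ hf), H]

theorem chartMap_velocity {e : OpenPartialHomeomorph M E} (he : e ∈ atlas E M) (g : Plot A E M)
    (hg : g 0 ∈ e.source) : chartMap e (velocity A g) = vjet A fun u => e (g u) := by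
  have h := velocity_eq_iff.1 (velocity_out (velocity A g))
  set k : Plot A E M := Quotient.out (velocity A g) with hk
  have hk0 : k 0 ∈ e.source := by rw [h.1]; exact hg
  change (vjet A fun u => e (k u)) = _
  funext c
  rw [← sub_eq_zero]
  refine SeparatingDual.eq_zero_of_forall_dual_eq_zero (R := ℝ) fun L => ?_
  have h1 : ContMDiffAt 𝓘(ℝ, E) 𝓘(ℝ, ℝ) ∞ (fun x => L (e x)) (k 0) :=
    (L.contDiff.contMDiff (n := ∞)).contMDiffAt.comp _
      (contMDiffAt_of_mem_maximalAtlas (IsManifold.subset_maximalAtlas he) hk0)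
  have h2 := h.2 _ h1
  rw [jet_eq, jet_eq] at h2
  have h3 := congrFun ((Module.finBasis ℝ A).equivFun.symm.injective h2) c
  rw [vjet_clm (contDiffAt_plot he k hk0), vjet_clm (contDiffAt_plot he g hg)] at h3
  rw [map_sub, h3, sub_self]

theorem exists_plot {e : OpenPartialHomeomorph M E} (he : e ∈ atlas E M) {v : Model A E}
    (hv : base A v ∈ e.target) :
    ∃ g : Plot A E M, g 0 = e.symm (base A v) ∧ (vjet A fun u => e (g u)) = v := by
  have := FiniteDimensional.complete ℝ E
  obtain ⟨γ, hγ, hγ0, hγv⟩ := exists_vjet_eq v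
  obtain ⟨ε, hε, hb⟩ := Metric.isOpen_iff.1 e.open_target _ hv
  have hc : ∀ᶠ u in 𝓝 0, γ u ∈ Metric.ball (base A v) ε := by
    have := hγ.continuous.continuousAt (x := 0)
    rw [ContinuousAt, hγ0] at this
    exact this (Metric.ball_mem_nhds _ hε)
  obtain ⟨δ, hδ, hd⟩ := Metric.eventually_nhds_iff_ball.1 hc
  let χ : ContDiffBump (0 : Fin (width A) → ℝ) := ⟨δ / 2, δ, by positivity, by linarith⟩
  let γ' : (Fin (width A) → ℝ) → E := fun u => base A v + χ u • (γ u - base A v)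
  have hγ' : ContDiff ℝ ∞ γ' :=
    contDiff_const.add (χ.contDiff.smul (hγ.sub contDiff_const))
  have hmem : ∀ u, γ' u ∈ e.target := by
    intro u
    apply hb
    rw [mem_ball_iff_norm, add_sub_cancel_left, norm_smul, Real.norm_of_nonneg χ.nonneg]
    by_cases hu : u ∈ Metric.ball 0 δ
    · have := hd u hu
      rw [mem_ball_iff_norm] at this
      exact (mul_le_of_le_one_left (norm_nonneg _) χ.le_one).trans_lt this
    · have : χ u = 0 := by
        apply χ.zero_of_le_dist
        simpa using hu
      rw [this, zero_mul]; exact hε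
  have heq : γ' =ᶠ[𝓝 0] γ := by
    filter_upwards [χ.eventuallyEq_one] with u hu
    simp [γ', hu]
  have hsm : ContMDiff 𝓘(ℝ, Fin (width A) → ℝ) 𝓘(ℝ, E) ∞ fun u => e.symm (γ' u) :=
    (contMDiffOn_symm_of_mem_maximalAtlas (IsManifold.subset_maximalAtlas he)).comp_contMDiff
      hγ'.contMDiff hmem
  refine ⟨⟨_, hsm⟩, ?_, ?_⟩
  · change e.symm (γ' 0) = _
    rw [heq.eq_of_nhds, hγ0]
  · change (vjet A fun u => e (e.symm (γ' u))) = v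
    rw [← hγv]
    apply vjet_congr
    filter_upwards [heq] with u hu
    rw [e.right_inv (hmem u), hu]

theorem chartMap_injOn {e : OpenPartialHomeomorph M E} (he : e ∈ atlas E M) {z w : WeilBundle A E M}
    (hz : proj A E M z ∈ e.source) (hw : proj A E M w ∈ e.source)
    (h : chartMap e z = chartMap e w) : z = w := by
  obtain ⟨g, rfl⟩ : ∃ g, velocity A g = z := ⟨_, velocity_out z⟩
  obtain ⟨k, rfl⟩ : ∃ g, velocity A g = w := ⟨_, velocity_out w⟩
  rw [chartMap_velocity he g hz, chartMap_velocity he k hw] at h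
  exact velocity_eq_of_vjet he hz hw h

theorem base_chartMap {e : OpenPartialHomeomorph M E} (he : e ∈ atlas E M) {z : WeilBundle A E M}
    (hz : proj A E M z ∈ e.source) : base A (chartMap e z) = e (proj A E M z) := by
  obtain ⟨g, rfl⟩ : ∃ g, velocity A g = z := ⟨_, velocity_out z⟩
  rw [chartMap_velocity he g hz]
  exact base_vjet_plot he g hz

theorem exists_chartMap_eq {e : OpenPartialHomeomorph M E} (he : e ∈ atlas E M) (v : Model A E) :
    ∃ z : WeilBundle A E M, base A v ∈ e.target →
      proj A E M z = e.symm (base A v) ∧ chartMap e z = v := by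
  by_cases hv : base A v ∈ e.target
  · obtain ⟨g, hg0, hg⟩ := exists_plot he hv
    refine ⟨velocity A g, fun _ => ⟨hg0, ?_⟩⟩
    rw [chartMap_velocity he g (by rw [hg0]; exact e.map_target hv), hg]
  · exact ⟨velocity A (ContMDiffMap.const (e.symm 0)), fun h => absurd h hv⟩

/-- The chart `T^A e` of `T^A M`, defined over the domain of the chart `e` of `M`. -/
noncomputable def liftChart (e : OpenPartialHomeomorph M E) (he : e ∈ atlas E M) :
    PartialEquiv (WeilBundle A E M) (Model A E) where
  toFun := chartMap e
  invFun v := (exists_chartMap_eq he v).choose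
  source := {z | proj A E M z ∈ e.source}
  target := {v | base A v ∈ e.target}
  map_source' z hz := by
    change base A (chartMap e z) ∈ e.target
    rw [base_chartMap he hz]
    exact e.map_source hz
  map_target' v hv := by
    change proj A E M _ ∈ e.source
    rw [((exists_chartMap_eq he v).choose_spec hv).1]
    exact e.map_target hv
  left_inv' z hz := by
    have hv : base A (chartMap e z) ∈ e.target := by
      rw [base_chartMap he hz]
      exact e.map_source hz
    have hs := (exists_chartMap_eq he (chartMap e z)).choose_spec hv
    refine chartMap_injOn he ?_ hz hs.2
    rw [hs.1]
    exact e.map_target hv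
  right_inv' v hv := ((exists_chartMap_eq he v).choose_spec hv).2

theorem proj_liftChart_symm {e : OpenPartialHomeomorph M E} (he : e ∈ atlas E M) {v : Model A E}
    (hv : base A v ∈ e.target) :
    proj A E M ((liftChart (A := A) e he).symm v) = e.symm (base A v) :=
  ((exists_chartMap_eq he v).choose_spec hv).1

theorem chartMap_eq_taylorMap {e e' : OpenPartialHomeomorph M E} (he : e ∈ atlas E M)
    (he' : e' ∈ atlas E M) {z : WeilBundle A E M} (hz : proj A E M z ∈ e.source)
    (hz' : proj A E M z ∈ e'.source) :
    chartMap e' z = taylorMap A (fun y => e' (e.symm y)) (chartMap e z) := by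
  obtain ⟨g, rfl⟩ : ∃ g, velocity A g = z := ⟨_, velocity_out z⟩
  rw [chartMap_velocity he g hz, chartMap_velocity he' g hz']
  exact vjet_plot he g hz
    (contMDiffAt_of_mem_maximalAtlas (IsManifold.subset_maximalAtlas he') hz')

theorem transition {e e' : OpenPartialHomeomorph M E} (he : e ∈ atlas E M) (he' : e' ∈ atlas E M) :
    ((liftChart (A := A) e he).symm.trans (liftChart e' he')).source =
      {v | base A v ∈ (e.symm.trans e').source} ∧
    ∀ v, base A v ∈ (e.symm.trans e').source →
      (liftChart (A := A) e he).symm.trans (liftChart e' he') v =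
        taylorMap A (fun y => e' (e.symm y)) v := by
  constructor
  · ext v
    simp only [PartialEquiv.trans_source, PartialEquiv.symm_source, Set.mem_inter_iff,
      Set.mem_preimage, Set.mem_ofPred_eq, OpenPartialHomeomorph.trans_source,
      OpenPartialHomeomorph.symm_source]
    refine and_congr_right fun hv => ?_
    change proj A E M _ ∈ e'.source ↔ _
    rw [proj_liftChart_symm he hv]
  · intro v hv
    rw [OpenPartialHomeomorph.trans_source] at hv
    have hv1 : base A v ∈ e.target := hv.1
    have hv2 : e.symm (base A v) ∈ e'.source := hv.2
    have hp := proj_liftChart_symm (A := A) he hv1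
    change chartMap e' ((liftChart (A := A) e he).symm v) = _
    rw [chartMap_eq_taylorMap he he' (by rw [hp]; exact e.map_target hv1) (by rw [hp]; exact hv2)]
    congr 1
    exact ((exists_chartMap_eq he v).choose_spec hv1).2

theorem contDiffOn_transition {e e' : OpenPartialHomeomorph M E} (he : e ∈ atlas E M)
    (he' : e' ∈ atlas E M) :
    ContDiffOn ℝ ∞ ((liftChart (A := A) e he).symm.trans (liftChart e' he'))
      ((liftChart (A := A) e he).symm.trans (liftChart e' he')).source := by
  have := FiniteDimensional.complete ℝ E
  rw [(transition he he').1]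
  refine ContDiffOn.congr ?_ (transition he he').2
  intro v hv
  refine (contDiffAt_taylorMap ?_).contDiffWithinAt
  have hv' := hv
  simp only [Set.mem_ofPred_eq, OpenPartialHomeomorph.trans_source] at hv'
  have h := contDiffAt_symm he (e.map_target hv'.1)
    (contMDiffAt_of_mem_maximalAtlas (IsManifold.subset_maximalAtlas he') hv'.2)
  rwa [e.right_inv hv'.1] at h

variable (A E M)

/-- The atlas of all charts `T^A e`, `e` in the atlas of `M`. -/
noncomputable def core : ChartedSpaceCore (Model A E) (WeilBundle A E M) where
  atlas := {c | ∃ (e : OpenPartialHomeomorph M E) (he : e ∈ atlas E M), c = liftChart e he}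
  chartAt z := liftChart (chartAt E (proj A E M z)) (chart_mem_atlas E _)
  mem_chart_source z := mem_chart_source E (proj A E M z)
  chart_mem_atlas z := ⟨_, _, rfl⟩
  open_source := by
    rintro _ _ ⟨e, he, rfl⟩ ⟨e', he', rfl⟩
    rw [(transition he he').1]
    exact (e.symm.trans e').open_source.preimage contDiff_base.continuous
  continuousOn_toFun := by
    rintro _ _ ⟨e, he, rfl⟩ ⟨e', he', rfl⟩
    exact (contDiffOn_transition he he').continuousOn

noncomputable instance : TopologicalSpace (WeilBundle A E M) := (core A E M).toTopologicalSpace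

noncomputable instance : ChartedSpace (Model A E) (WeilBundle A E M) := (core A E M).toChartedSpace

instance : IsManifold 𝓘(ℝ, Model A E) ∞ (WeilBundle A E M) := by
  apply isManifold_of_contDiffOn
  intro c c' hc hc'
  obtain ⟨_, ⟨e, he, rfl⟩, rfl⟩ : ∃ (c₀ : _) (h : c₀ ∈ (core A E M).atlas),
      c = (core A E M).openPartialHomeomorph c₀ h := by
    simpa [atlas, ChartedSpace.atlas, ChartedSpaceCore.toChartedSpace] using hc
  obtain ⟨_, ⟨e', he', rfl⟩, rfl⟩ : ∃ (c₀ : _) (h : c₀ ∈ (core A E M).atlas),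
      c' = (core A E M).openPartialHomeomorph c₀ h := by
    simpa [atlas, ChartedSpace.atlas, ChartedSpaceCore.toChartedSpace] using hc'
  have h := contDiffOn_transition (A := A) he he'
  simp only [modelWithCornersSelf_coe, modelWithCornersSelf_coe_symm, Set.range_id, Set.inter_univ,
    Function.id_comp, Function.comp_id, Set.preimage_id]
  exact h

end Bundle

section Mixed

variable {V W G : Type*} [NormedAddCommGroup V] [NormedSpace ℝ V] [NormedAddCommGroup W]
  [NormedSpace ℝ W] [NormedAddCommGroup G] [NormedSpace ℝ G]

/-- Iterated directional derivatives. -/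
noncomputable def dirDeriv : List V → (V → G) → V → G
  | [], Φ => Φ
  | h :: L, Φ => fun q => fderiv ℝ (dirDeriv L Φ) q h

theorem contDiffAt_dirDeriv (L : List V) : ∀ {n : ℕ} {Φ : V → G} {p : V},
    ContDiffAt ℝ (n + L.length : ℕ) Φ p → ContDiffAt ℝ n (dirDeriv L Φ) p := by
  induction L with
  | nil => intro n Φ p h; exact h
  | cons a L ih =>
    intro n Φ p h
    have h1 : ContDiffAt ℝ (n + 1 : ℕ) (dirDeriv L Φ) p := by
      apply ih
      convert h using 2
      simp; ring
    exact (h1.fderiv_right (m := n) (by norm_cast)).clm_apply contDiffAt_const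

theorem iteratedFDeriv_eq_dirDeriv : ∀ {n : ℕ} {Φ : V → G} {p : V} (h : Fin n → V),
    ContDiffAt ℝ n Φ p → iteratedFDeriv ℝ n Φ p h = dirDeriv (List.ofFn h) Φ p := by
  intro n
  induction n with
  | zero => intro Φ p h _; simp [dirDeriv]
  | succ n ih =>
    intro Φ p h hΦ
    rw [List.ofFn_succ, dirDeriv]
    have hd : DifferentiableAt ℝ (iteratedFDeriv ℝ n Φ) p :=
      hΦ.differentiableAt_iteratedFDeriv (by norm_cast; omega)
    rw [hd.iteratedFDeriv_succ_apply_left']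
    have : (fun q => iteratedFDeriv ℝ n Φ q (Fin.tail h)) =ᶠ[𝓝 p]
        dirDeriv (List.ofFn fun i : Fin n => h i.succ) Φ := by
      filter_upwards [hΦ.eventually (by simp)] with q hq
      exact ih _ (hq.of_le (by norm_cast; omega))
    change _ = fderiv ℝ (dirDeriv (List.ofFn fun i : Fin n => h i.succ) Φ) p (h 0)
    rw [← this.fderiv_eq]

theorem dirDeriv_append (L L' : List V) (Φ : V → G) :
    dirDeriv (L ++ L') Φ = dirDeriv L (dirDeriv L' Φ) := by
  induction L with
  | nil => rfl
  | cons a L ih => simp only [List.cons_append, dirDeriv, ih]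

theorem dirDeriv_comp (x : W) (T : V →L[ℝ] W) (L : List V) : ∀ {Φ : W → G} {q : V},
    ContDiffAt ℝ L.length Φ (x + T q) →
      dirDeriv L (fun q => Φ (x + T q)) q = dirDeriv (L.map T) Φ (x + T q) := by
  induction L with
  | nil => intro Φ q _; rfl
  | cons a L ih =>
    intro Φ q h
    simp only [List.map_cons, dirDeriv]
    have hcont : ContinuousAt (fun q => x + T q) q := by fun_prop
    have e : dirDeriv L (fun q => Φ (x + T q)) =ᶠ[𝓝 q]
        fun q => dirDeriv (L.map T) Φ (x + T q) := by
      filter_upwards [hcont.eventually (h.eventually (by simp))] with q hq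
      exact ih (hq.of_le (by simp))
    rw [e.fderiv_eq]
    have hd : DifferentiableAt ℝ (dirDeriv (L.map T) Φ) (x + T q) := by
      refine (contDiffAt_dirDeriv (n := 1) _ ?_).differentiableAt (by simp)
      convert h using 2
      simp; ring
    have h2 : HasFDerivAt (fun q => x + T q) T q := T.hasFDerivAt.const_add x
    have := (hd.hasFDerivAt.comp q h2).fderiv
    rw [show (fun q => dirDeriv (L.map T) Φ (x + T q)) =
      (dirDeriv (L.map T) Φ) ∘ (fun q => x + T q) from rfl, this]
    rfl

theorem dirDeriv_perm {L L' : List V} (h : L.Perm L') : ∀ {Φ : V → G} {p : V},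
    ContDiffAt ℝ L.length Φ p → dirDeriv L Φ p = dirDeriv L' Φ p := by
  induction h with
  | nil => intro Φ p _; rfl
  | @cons a l₁ l₂ h ih =>
    intro Φ p hΦ
    simp only [dirDeriv]
    have e : dirDeriv l₁ Φ =ᶠ[𝓝 p] dirDeriv l₂ Φ := by
      filter_upwards [hΦ.eventually (by simp)] with q hq
      exact ih (hq.of_le (by simp))
    rw [e.fderiv_eq]
  | swap a b L =>
    intro Φ p hΦ
    simp only [dirDeriv]
    have h2 : ContDiffAt ℝ (2 : ℕ) (dirDeriv L Φ) p := by
      apply contDiffAt_dirDeriv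
      convert hΦ using 2
      simp; ring
    have h3 : DifferentiableAt ℝ (fderiv ℝ (dirDeriv L Φ)) p :=
      (h2.fderiv_right (m := 1) (by norm_cast)).differentiableAt (by simp)
    have hs : IsSymmSndFDerivAt ℝ (dirDeriv L Φ) p :=
      h2.isSymmSndFDerivAt (by simp)
    rw [fderiv_clm_apply h3 (by fun_prop), fderiv_clm_apply h3 (by fun_prop)]
    simpa using hs b a
  | trans h1 h2 ih1 ih2 =>
    intro Φ p hΦ
    rw [ih1 hΦ, ih2 (by rwa [← h1.length_eq])]

theorem mixed_aux {U : Type*} [NormedAddCommGroup U] [NormedSpace ℝ U] {Φ : U → G}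
    (S : V →L[ℝ] U) (T : W →L[ℝ] U) (hΦ : ContDiffAt ℝ ∞ Φ 0) {m l : ℕ} (k : Fin m → V)
    (h : Fin l → W) :
    ContDiffAt ℝ ∞ (fun u => iteratedFDeriv ℝ l (fun w => Φ (S u + T w)) 0 h) 0 ∧
    iteratedFDeriv ℝ m (fun u => iteratedFDeriv ℝ l (fun w => Φ (S u + T w)) 0 h) 0 k =
      dirDeriv ((List.ofFn k).map S ++ (List.ofFn h).map T) Φ 0 := by
  have e : (fun u => iteratedFDeriv ℝ l (fun w => Φ (S u + T w)) 0 h) =ᶠ[𝓝 0]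
      fun u => dirDeriv ((List.ofFn h).map T) Φ (0 + S u) := by
    have hc : ContinuousAt (fun u => S u) 0 := by fun_prop
    have h1 : ∀ᶠ y in 𝓝 (S 0), ContDiffAt ℝ l Φ y := by
      rw [map_zero]
      exact (hΦ.of_le (m := l) (by exact_mod_cast le_top)).eventually (by simp)
    filter_upwards [hc.eventually h1] with u hu
    have hu' : ContDiffAt ℝ l Φ (S u + T 0) := by rwa [map_zero, add_zero]
    rw [iteratedFDeriv_eq_dirDeriv, dirDeriv_comp (S u) T]
    · simp
    · simpa using hu
    · exact hu'.comp (0 : W) (by fun_prop)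
  have hn : ∀ n : ℕ, ContDiffAt ℝ n (dirDeriv ((List.ofFn h).map T) Φ) 0 := fun n =>
    contDiffAt_dirDeriv _ (hΦ.of_le (by exact_mod_cast le_top))
  have hn' : ∀ n : ℕ, ContDiffAt ℝ n (dirDeriv ((List.ofFn h).map T) Φ) (0 + S 0) := by
    simpa using hn
  constructor
  · refine ContDiffAt.congr_of_eventuallyEq ?_ e
    refine contDiffAt_infty.2 fun n => ?_
    exact (hn' n).comp (0 : V) (by fun_prop)
  · rw [(e.iteratedFDeriv ℝ m).eq_of_nhds, iteratedFDeriv_eq_dirDeriv, dirDeriv_comp 0 S,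
      dirDeriv_append]
    · simp
    · exact hn' _
    · exact (hn' _).comp (0 : V) (by fun_prop)

variable {A : Type*} [CommRing A] [Algebra ℝ A] [WeilAlgebra A]
variable {B : Type*} [CommRing B] [Algebra ℝ B] [WeilAlgebra B]

theorem vjet_vjet_aux {U : Type*} [NormedAddCommGroup U] [NormedSpace ℝ U] {Φ : U → G}
    (S : (Fin (width A) → ℝ) →L[ℝ] U) (T : (Fin (width B) → ℝ) →L[ℝ] U)
    (hΦ : ContDiffAt ℝ ∞ Φ 0) (a : Fin (Module.finrank ℝ A)) (b : Fin (Module.finrank ℝ B)) :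
    vjet A (fun u => vjet B (fun w => Φ (S u + T w)) b) a =
      ∑ x ∈ (Finset.range (nilOrder A)).sigma fun m => (Finset.univ : Finset (Fin m → Fin (width A))),
      ∑ y ∈ (Finset.range (nilOrder B)).sigma fun m => (Finset.univ : Finset (Fin m → Fin (width B))),
      ((x.1.factorial : ℝ)⁻¹ * (Module.finBasis ℝ A).repr (∏ t, gen A (x.2 t)) a *
        ((y.1.factorial : ℝ)⁻¹ * (Module.finBasis ℝ B).repr (∏ t, gen B (y.2 t)) b)) •
      dirDeriv ((List.ofFn fun t => Pi.single (x.2 t) 1).map S ++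
        (List.ofFn fun t => Pi.single (y.2 t) 1).map T) Φ 0 := by
  rw [Finset.sum_sigma]
  conv_lhs => unfold vjet
  refine Finset.sum_congr rfl fun m _ => ?_
  rw [Finset.smul_sum]
  refine Finset.sum_congr rfl fun i _ => ?_
  have hs : ∀ (l : ℕ) (j : Fin l → Fin (width B)), ContDiffAt ℝ m (fun u =>
        iteratedFDeriv ℝ l (fun w => Φ (S u + T w)) 0 fun t => Pi.single (j t) 1) 0 :=
    fun l j => (mixed_aux S T hΦ (fun t => Pi.single (i t) 1) _).1.of_le (by exact_mod_cast le_top)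
  rw [Finset.sum_sigma, iteratedFDeriv_fun_sum_apply]
  · rw [_root_.sum_apply, Finset.smul_sum, Finset.smul_sum]
    refine Finset.sum_congr rfl fun l _ => ?_
    rw [iteratedFDeriv_const_smul_apply', iteratedFDeriv_fun_sum_apply]
    · rw [_root_.smul_apply, _root_.sum_apply]
      simp only [Finset.smul_sum]
      refine Finset.sum_congr rfl fun j _ => ?_
      rw [iteratedFDeriv_const_smul_apply' (hs l j), _root_.smul_apply,
        (mixed_aux S T hΦ _ _).2]
      simp only [smul_smul]
      congr 1
      ring
    · exact fun j _ => contDiffAt_const.smul (hs l j)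
    · exact ContDiffAt.sum fun j _ => contDiffAt_const.smul (hs l j)
  · exact fun l _ => contDiffAt_const.smul
      (ContDiffAt.sum fun j _ => contDiffAt_const.smul (hs l j))

theorem vjet_vjet {U : Type*} [NormedAddCommGroup U] [NormedSpace ℝ U] {Φ : U → G}
    (S : (Fin (width A) → ℝ) →L[ℝ] U) (T : (Fin (width B) → ℝ) →L[ℝ] U)
    (hΦ : ContDiffAt ℝ ∞ Φ 0) (a : Fin (Module.finrank ℝ A)) (b : Fin (Module.finrank ℝ B)) :
    vjet A (fun u => vjet B (fun w => Φ (S u + T w)) b) a =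
      vjet B (fun w => vjet A (fun u => Φ (T w + S u)) a) b := by
  rw [vjet_vjet_aux S T hΦ a b, vjet_vjet_aux T S hΦ b a, Finset.sum_comm]
  refine Finset.sum_congr rfl fun y _ => Finset.sum_congr rfl fun x _ => ?_
  rw [mul_comm]
  congr 1
  exact dirDeriv_perm List.perm_append_comm (hΦ.of_le (by exact_mod_cast le_top))

variable (A B) in
/-- Exchanging the two factors, `(E ⊗ B) ⊗ A → (E ⊗ A) ⊗ B`. -/
def swap {E : Type*} (v : Model A (Model B E)) : Model B (Model A E) := fun b a => v a b

theorem base_swap {E : Type*} [NormedAddCommGroup E] [NormedSpace ℝ E] (v : Model A (Model B E)) :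
    base A (base B (swap A B v)) = base B (base A v) := by
  simp only [base, swap, Finset.smul_sum, Finset.sum_apply, Pi.smul_apply]
  rw [Finset.sum_comm]
  exact Finset.sum_congr rfl fun _ _ => Finset.sum_congr rfl fun _ _ => smul_comm _ _ _

theorem taylorMap_taylorMap {E : Type*} [NormedAddCommGroup E] [NormedSpace ℝ E] [CompleteSpace E]
    [CompleteSpace G] {F : E → G} {v : Model A (Model B E)}
    (hF : ContDiffAt ℝ ∞ F (base B (base A v)))
    {p : Fin (Module.finrank ℝ A) → (Fin (width A) → ℝ) → ℝ}
    {q : Fin (Module.finrank ℝ B) → (Fin (width B) → ℝ) → ℝ}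
    (hp : ∀ c, ContDiff ℝ ∞ (p c)) (hq : ∀ c, ContDiff ℝ ∞ (q c))
    (hpv : ∀ v : Model A (Model B E),
      ∑ c, p c 0 • v c = base A v ∧ vjet A (fun u => ∑ c, p c u • v c) = v)
    (hqv : ∀ v : Model B E, ∑ c, q c 0 • v c = base B v ∧ vjet B (fun u => ∑ c, q c u • v c) = v)
    (a : Fin (Module.finrank ℝ A)) (b : Fin (Module.finrank ℝ B)) :
    taylorMap A (fun y => taylorMap B F y b) v a =
      vjet A (fun u => vjet B (fun w => F (∑ c, q c w • ∑ a, p a u • v a c)) b) a := by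
  have hγ : ContDiff ℝ ∞ fun u => ∑ c, p c u • v c :=
    ContDiff.sum fun i _ => (hp i).smul contDiff_const
  have h1 : ContDiffAt ℝ ∞ (fun y => taylorMap B F y b) (base A v) :=
    contDiffAt_pi.1 (contDiffAt_taylorMap hF) b
  have h2 := (vjet_comp (A := A) (F := fun y => taylorMap B F y b) (γ := fun u => ∑ c, p c u • v c)
    (by rw [(hpv v).1]; exact h1.of_le (by exact_mod_cast le_top))
    (hγ.contDiffAt.of_le (by exact_mod_cast le_top))).2
  rw [(hpv v).2] at h2
  rw [← h2]
  refine congrFun (vjet_congr ?_) a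
  have hc : ContinuousAt (fun u => base B (∑ c, p c u • v c)) 0 :=
    (contDiff_base.continuous.comp hγ.continuous).continuousAt
  have h3 : ∀ᶠ y in 𝓝 (base B (∑ c, p c 0 • v c)), ContDiffAt ℝ (nilOrder B) F y := by
    rw [(hpv v).1]
    exact (hF.of_le (m := (nilOrder B : ℕ)) (by exact_mod_cast le_top)).eventually (by simp)
  filter_upwards [hc.eventually h3] with u hu
  have hδ : ContDiff ℝ ∞ fun w => ∑ c, q c w • (∑ c, p c u • v c) c :=
    ContDiff.sum fun i _ => (hq i).smul contDiff_const
  have h4 := (vjet_comp (A := B) (F := F) (γ := fun w => ∑ c, q c w • (∑ c, p c u • v c) c)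
    (by rw [(hqv _).1]; exact hu)
    (hδ.contDiffAt.of_le (by exact_mod_cast le_top))).2
  rw [(hqv _).2] at h4
  rw [← h4]
  simp only [Finset.sum_apply, Pi.smul_apply]

theorem taylorMap_swap {E : Type*} [NormedAddCommGroup E] [NormedSpace ℝ E] [CompleteSpace E]
    [CompleteSpace G] {F : E → G} {v : Model A (Model B E)}
    (hF : ContDiffAt ℝ ∞ F (base B (base A v))) (a : Fin (Module.finrank ℝ A))
    (b : Fin (Module.finrank ℝ B)) :
    taylorMap B (fun y => taylorMap A F y a) (swap A B v) b =
      taylorMap A (fun y => taylorMap B F y b) v a := by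
  obtain ⟨p, hp, hpv⟩ := exists_section A
  obtain ⟨q, hq, hqv⟩ := exists_section B
  rw [taylorMap_taylorMap hF hp hq (hpv _) (hqv _),
    taylorMap_taylorMap (by rw [base_swap]; exact hF) hq hp (hqv _) (hpv _)]
  let Φ : (Fin (width A) → ℝ) × (Fin (width B) → ℝ) → G := fun x =>
    F (∑ c, q c x.2 • ∑ a, p a x.1 • v a c)
  have hΦ : ContDiffAt ℝ ∞ Φ 0 := by
    have hin : ContDiff ℝ ∞ fun x : (Fin (width A) → ℝ) × (Fin (width B) → ℝ) =>
        ∑ c, q c x.2 • ∑ a, p a x.1 • v a c :=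
      ContDiff.sum fun c _ => ((hq c).comp contDiff_snd).smul
        (ContDiff.sum fun a _ => ((hp a).comp contDiff_fst).smul contDiff_const)
    refine ContDiffAt.comp (0 : (Fin (width A) → ℝ) × (Fin (width B) → ℝ)) ?_ hin.contDiffAt
    have h0 : ∑ c, q c 0 • ∑ a, p a 0 • v a c = base B (base A v) := by
      rw [← (hqv E (base A v)).1, ← (hpv (Model B E) v).1]
      simp only [Finset.sum_apply, Pi.smul_apply]
    change ContDiffAt ℝ ∞ F (∑ c, q c 0 • ∑ a, p a 0 • v a c)
    rw [h0]; exact hF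
  have key := vjet_vjet (Φ := Φ) (ContinuousLinearMap.inl ℝ _ _) (ContinuousLinearMap.inr ℝ _ _)
    hΦ a b
  have e : ∀ (u : Fin (width A) → ℝ) (w : Fin (width B) → ℝ),
      ∑ c, p c u • ∑ a, q a w • swap A B v a c = ∑ c, q c w • ∑ a, p a u • v a c := by
    intro u w
    simp only [Finset.smul_sum, swap]
    rw [Finset.sum_comm]
    exact Finset.sum_congr rfl fun _ _ => Finset.sum_congr rfl fun _ _ => smul_comm _ _ _
  simp only [e]
  simpa [Φ] using key.symm

end Mixed

section Functor

variable (A : Type*) [CommRing A] [Algebra ℝ A] [WeilAlgebra A]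
variable (B : Type*) [CommRing B] [Algebra ℝ B] [WeilAlgebra B]
variable {E : Type*} [NormedAddCommGroup E] [NormedSpace ℝ E] [FiniteDimensional ℝ E]
variable {M : Type*} [TopologicalSpace M] [ChartedSpace E M] [IsManifold 𝓘(ℝ, E) ∞ M]
variable {E' : Type*} [NormedAddCommGroup E'] [NormedSpace ℝ E'] [FiniteDimensional ℝ E']
variable {M' : Type*} [TopologicalSpace M'] [ChartedSpace E' M'] [IsManifold 𝓘(ℝ, E') ∞ M']

/-- The chart `T^A e` of `T^A M` as an open partial homeomorphism. -/
noncomputable def bundleChart (e : OpenPartialHomeomorph M E) (he : e ∈ atlas E M) :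
    OpenPartialHomeomorph (WeilBundle A E M) (Model A E) :=
  (core A E M).openPartialHomeomorph (liftChart e he) ⟨e, he, rfl⟩

variable {e : OpenPartialHomeomorph M E}

theorem bundleChart_mem (he : e ∈ atlas E M) : bundleChart A e he ∈ atlas (Model A E) (WeilBundle A E M) :=
  Set.mem_iUnion.2 ⟨liftChart e he, Set.mem_iUnion.2 ⟨⟨e, he, rfl⟩, rfl⟩⟩

theorem bundleChart_source (he : e ∈ atlas E M) : (bundleChart A e he).source = {z | proj A E M z ∈ e.source} := rfl

theorem bundleChart_target (he : e ∈ atlas E M) : (bundleChart A e he).target = {v | base A v ∈ e.target} := rfl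

theorem bundleChart_apply (he : e ∈ atlas E M) (z : WeilBundle A E M) : bundleChart A e he z = chartMap e z := rfl

theorem proj_bundleChart_symm (he : e ∈ atlas E M) {v : Model A E} (hv : base A v ∈ e.target) :
    proj A E M ((bundleChart A e he).symm v) = e.symm (base A v) :=
  proj_liftChart_symm he hv

variable (E M) in
theorem contMDiff_proj : ContMDiff 𝓘(ℝ, Model A E) 𝓘(ℝ, E) ∞ (proj A E M) := by
  intro z
  have he := chart_mem_atlas E (proj A E M z)
  set e := chartAt E (proj A E M z)
  have hz : z ∈ (bundleChart A e he).source := mem_chart_source E (proj A E M z)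
  have h1 : ContMDiffAt 𝓘(ℝ, Model A E) 𝓘(ℝ, Model A E) ∞ (bundleChart A e he) z :=
    contMDiffAt_of_mem_maximalAtlas (IsManifold.subset_maximalAtlas (bundleChart_mem A he)) hz
  have h2 : ContMDiffAt 𝓘(ℝ, E) 𝓘(ℝ, E) ∞ e.symm (base A (bundleChart A e he z)) := by
    refine contMDiffAt_symm_of_mem_maximalAtlas (IsManifold.subset_maximalAtlas he) ?_
    exact (bundleChart A e he).map_source hz
  have h3 : ContMDiffAt 𝓘(ℝ, Model A E) 𝓘(ℝ, E) ∞
      (fun z => e.symm (base A (bundleChart A e he z))) z :=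
    h2.comp z (contDiff_base.contMDiff.contMDiffAt.comp z h1)
  refine h3.congr_of_eventuallyEq ?_
  filter_upwards [(bundleChart A e he).open_source.mem_nhds hz] with y hy
  rw [bundleChart_apply, base_chartMap he hy, e.left_inv hy]

variable (E M) in
/-- The bundle projection `p^A_M : T^A M → M` as a smooth map. -/
noncomputable def projection : C^∞⟮𝓘(ℝ, Model A E), WeilBundle A E M; 𝓘(ℝ, E), M⟯ :=
  ⟨proj A E M, contMDiff_proj A E M⟩

/-- The map underlying `T^A f`: it sends `j^A g` to `j^A (f ∘ g)`. -/
noncomputable def mapFun (f : C^∞⟮𝓘(ℝ, E), M; 𝓘(ℝ, E'), M'⟯) :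
    WeilBundle A E M → WeilBundle A E' M' :=
  Quotient.map (fun g : Plot A E M => f.comp g) fun g _ hgh => ⟨congrArg f hgh.1, fun a ha =>
    hgh.2 (fun x => a (f x)) (ContMDiffAt.comp (g 0) ha f.contMDiff.contMDiffAt)⟩

theorem mapFun_velocity (f : C^∞⟮𝓘(ℝ, E), M; 𝓘(ℝ, E'), M'⟯) (g : Plot A E M) :
    mapFun A f (velocity A g) = velocity A (f.comp g) := rfl

theorem proj_mapFun (f : C^∞⟮𝓘(ℝ, E), M; 𝓘(ℝ, E'), M'⟯) (z : WeilBundle A E M) :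
    proj A E' M' (mapFun A f z) = f (proj A E M z) := by
  obtain ⟨g, rfl⟩ : ∃ g, velocity A g = z := ⟨_, velocity_out z⟩
  rfl

/-- If `f : M → M'` corresponds to `F` in charts with smooth transition, then so does `T^A f`. -/
theorem chartMap_mapFun (he : e ∈ atlas E M)
    (f : C^∞⟮𝓘(ℝ, E), M; 𝓘(ℝ, E'), M'⟯) {e' : OpenPartialHomeomorph M' E'}
    (he' : e' ∈ atlas E' M') {z : WeilBundle A E M} (hz : proj A E M z ∈ e.source)
    (hz' : f (proj A E M z) ∈ e'.source) :
    chartMap e' (mapFun A f z) = taylorMap A (fun y => e' (f (e.symm y))) (chartMap e z) := by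
  obtain ⟨g, rfl⟩ : ∃ g, velocity A g = z := ⟨_, velocity_out z⟩
  rw [mapFun_velocity, chartMap_velocity he' _ hz', chartMap_velocity he g hz]
  exact vjet_plot he g hz (f := fun x => e' (f x)) (ContMDiffAt.comp _
    (contMDiffAt_of_mem_maximalAtlas (IsManifold.subset_maximalAtlas he') hz')
    f.contMDiff.contMDiffAt)

theorem contMDiffAt_of_chart {X : Type*} {H : Type*} [NormedAddCommGroup H] [NormedSpace ℝ H]
    [TopologicalSpace X] [ChartedSpace H X] [IsManifold 𝓘(ℝ, H) ∞ X]
    {Y : Type*} {K : Type*} [NormedAddCommGroup K] [NormedSpace ℝ K]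
    [TopologicalSpace Y] [ChartedSpace K Y] [IsManifold 𝓘(ℝ, K) ∞ Y]
    {c : OpenPartialHomeomorph X H} (hc : c ∈ atlas H X) {d : OpenPartialHomeomorph Y K}
    (hd : d ∈ atlas K Y) {ψ : X → Y} {Ψ : H → K} {x : X} (hx : x ∈ c.source)
    (hΨ : ContDiffAt ℝ ∞ Ψ (c x)) (h : ∀ᶠ y in 𝓝 x, ψ y ∈ d.source ∧ d (ψ y) = Ψ (c y)) :
    ContMDiffAt 𝓘(ℝ, H) 𝓘(ℝ, K) ∞ ψ x := by
  have h1 : ContMDiffAt 𝓘(ℝ, H) 𝓘(ℝ, H) ∞ c x :=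
    contMDiffAt_of_mem_maximalAtlas (IsManifold.subset_maximalAtlas hc) hx
  have h2 : ContMDiffAt 𝓘(ℝ, K) 𝓘(ℝ, K) ∞ d.symm (Ψ (c x)) := by
    refine contMDiffAt_symm_of_mem_maximalAtlas (IsManifold.subset_maximalAtlas hd) ?_
    rw [← h.self_of_nhds.2]
    exact d.map_source h.self_of_nhds.1
  have h3 : ContMDiffAt 𝓘(ℝ, H) 𝓘(ℝ, K) ∞ (fun y => d.symm (Ψ (c y))) x :=
    h2.comp x (hΨ.contMDiffAt.comp x h1)
  refine h3.congr_of_eventuallyEq ?_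
  filter_upwards [h] with y hy
  rw [← hy.2, d.left_inv hy.1]

theorem contMDiff_mapFun (f : C^∞⟮𝓘(ℝ, E), M; 𝓘(ℝ, E'), M'⟯) :
    ContMDiff 𝓘(ℝ, Model A E) 𝓘(ℝ, Model A E') ∞ (mapFun A f) := by
  have := FiniteDimensional.complete ℝ E'
  intro z
  have he := chart_mem_atlas E (proj A E M z)
  set e := chartAt E (proj A E M z)
  have he' := chart_mem_atlas E' (f (proj A E M z))
  set e' := chartAt E' (f (proj A E M z))
  have hz : proj A E M z ∈ e.source := mem_chart_source E (proj A E M z)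
  have hz' : f (proj A E M z) ∈ e'.source := mem_chart_source E' (f (proj A E M z))
  refine contMDiffAt_of_chart (bundleChart_mem A he) (bundleChart_mem A he') hz
    (Ψ := taylorMap A fun y => e' (f (e.symm y))) ?_ ?_
  · apply contDiffAt_taylorMap
    rw [bundleChart_apply, base_chartMap he hz]
    exact contDiffAt_symm he hz (f := fun x => e' (f x)) (ContMDiffAt.comp _
      (contMDiffAt_of_mem_maximalAtlas (IsManifold.subset_maximalAtlas he') hz')
      f.contMDiff.contMDiffAt)
  · have hc : ContinuousAt (fun z => f (proj A E M z)) z :=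
      (f.contMDiff.continuous.comp (contMDiff_proj A E M).continuous).continuousAt
    filter_upwards [(bundleChart A e he).open_source.mem_nhds hz,
      hc.preimage_mem_nhds (e'.open_source.mem_nhds hz')] with y hy hy'
    refine ⟨?_, chartMap_mapFun A he f he' hy hy'⟩
    rw [bundleChart_source, Set.mem_ofPred_eq, proj_mapFun]
    exact hy'

/-- The functor `T^A` on smooth maps: `T^A f (j^A g) = j^A (f ∘ g)`. -/
noncomputable def map (f : C^∞⟮𝓘(ℝ, E), M; 𝓘(ℝ, E'), M'⟯) :
    C^∞⟮𝓘(ℝ, Model A E), WeilBundle A E M; 𝓘(ℝ, Model A E'), WeilBundle A E' M'⟯ :=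
  ⟨mapFun A f, contMDiff_mapFun A f⟩

/-- For (a germ of) a smooth function `f : M → ℝ`, the map `T^A f : T^A M → T^A ℝ = A`, which sends
`j^A g` to the image of `f ∘ g` in `A`. It does not depend on the choice of `g`. -/
noncomputable def ev (f : M → ℝ) (z : WeilBundle A E M) : A :=
  jet A (fun u => f ((Quotient.out z : Plot A E M) u))

theorem ev_velocity {f : M → ℝ} (g : Plot A E M)
    (hf : ContMDiffAt 𝓘(ℝ, E) 𝓘(ℝ, ℝ) ∞ f (g 0)) :
    ev A f (velocity A g) = jet A (fun u => f (g u)) := by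
  have h := velocity_eq_iff.1 (velocity_out (velocity A g))
  exact h.2 f (by rw [h.1]; exact hf)

/-- For (a germ of) a smooth function `f : M → ℝ`, the map
`T^A T^B f : T^A T^B M → T^A T^B ℝ = T^A B = A ⊗ B`; the coordinates of `T^B f : T^B M → B` with
respect to a basis of `B` are real functions, to which `T^A` is applied. -/
noncomputable def ev₂ (f : M → ℝ) (z : WeilBundle A (Model B E) (WeilBundle B E M)) : A ⊗[ℝ] B :=
  ∑ c, ev A (fun y => (Module.finBasis ℝ B).repr (ev B f y) c) z ⊗ₜ[ℝ] Module.finBasis ℝ B c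

/-- `w ∈ T^B T^A M` corresponds to `z ∈ T^A T^B M` under the exchange map `A ⊗ B → B ⊗ A`: they lie
over the same point of `M` and `T^B T^A f (w)` is the image of `T^A T^B f (z)` under the exchange
map, for all (germs of) smooth functions `f` on `M` at this point. -/
def IsExchange (z : WeilBundle A (Model B E) (WeilBundle B E M))
    (w : WeilBundle B (Model A E) (WeilBundle A E M)) : Prop :=
  proj A E M (proj B _ _ w) = proj B E M (proj A _ _ z) ∧
  ∀ f : M → ℝ, ContMDiffAt 𝓘(ℝ, E) 𝓘(ℝ, ℝ) ∞ f (proj B E M (proj A _ _ z)) →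
    ev₂ B A f w = Algebra.TensorProduct.comm ℝ A B (ev₂ A B f z)

theorem ev_eq (he : e ∈ atlas E M) {f : M → ℝ} {z : WeilBundle A E M} (hz : proj A E M z ∈ e.source)
    (hf : ContDiffAt ℝ (nilOrder A) (fun y => f (e.symm y)) (e (proj A E M z))) :
    ev A f z = (Module.finBasis ℝ A).equivFun.symm
      (taylorMap A (fun y => f (e.symm y)) (chartMap e z)) := by
  have h0 : (Quotient.out z : Plot A E M) 0 = proj A E M z := by
    conv_rhs => rw [← velocity_out z]
    rfl
  rw [ev, jet_eq, vjet_plot_of_contDiffAt he _ (by rw [h0]; exact hz) (by rw [h0]; exact hf)]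
  rfl

theorem ev₂_eq (he : e ∈ atlas E M) {f : M → ℝ} {z : WeilBundle A (Model B E) (WeilBundle B E M)}
    (hz : proj B E M (proj A _ _ z) ∈ e.source)
    (hf : ContMDiffAt 𝓘(ℝ, E) 𝓘(ℝ, ℝ) ∞ f (proj B E M (proj A _ _ z))) :
    ContDiffAt ℝ ∞ (fun y => f (e.symm y)) (base B (base A (chartMap (bundleChart B e he) z))) ∧
    ev₂ A B f z = ∑ b, ∑ a, taylorMap A (fun y => taylorMap B (fun y => f (e.symm y)) y b)
        (chartMap (bundleChart B e he) z) a •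
        (Module.finBasis ℝ A a ⊗ₜ[ℝ] Module.finBasis ℝ B b) := by
  have hF : ContDiffAt ℝ ∞ (fun y => f (e.symm y)) (e (proj B E M (proj A _ _ z))) :=
    contDiffAt_symm he hz hf
  have hz1 : proj A _ _ z ∈ (bundleChart B e he).source := hz
  have hb : base A (chartMap (bundleChart B e he) z) = chartMap e (proj A _ _ z) :=
    base_chartMap (bundleChart_mem B he) hz1
  have hbb : base B (base A (chartMap (bundleChart B e he) z)) =
      e (proj B E M (proj A _ _ z)) := by
    rw [hb, base_chartMap he hz]
  refine ⟨by rw [hbb]; exact hF, ?_⟩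
  rw [ev₂]
  refine Finset.sum_congr rfl fun b _ => ?_
  have heq : (fun y => (Module.finBasis ℝ B).repr (ev B f ((bundleChart B e he).symm y)) b)
      =ᶠ[𝓝 (base A (chartMap (bundleChart B e he) z))]
      fun y => taylorMap B (fun y => f (e.symm y)) y b := by
    have hc : ContinuousAt (base B : Model B E → E)
        (base A (chartMap (bundleChart B e he) z)) := contDiff_base.continuous.continuousAt
    have h1 : ∀ᶠ y in 𝓝 (base B (base A (chartMap (bundleChart B e he) z))),
        ContDiffAt ℝ (nilOrder B) (fun y => f (e.symm y)) y ∧ y ∈ e.target := by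
      rw [hbb]
      exact ((hF.of_le (m := (nilOrder B : ℕ)) (by exact_mod_cast le_top)).eventually
        (by simp)).and (e.open_target.mem_nhds (e.map_source hz))
    filter_upwards [hc.eventually h1] with y hy
    have hp := proj_bundleChart_symm B he hy.2
    rw [ev_eq B he (by rw [hp]; exact e.map_target hy.2)
      (by rw [hp, e.right_inv hy.2]; exact hy.1)]
    have hr : chartMap e ((bundleChart B e he).symm y) = y :=
      (bundleChart B e he).right_inv hy.2
    rw [hr, ← Module.Basis.equivFun_apply, LinearEquiv.apply_symm_apply]
  have hsm : ContDiffAt ℝ ∞ (fun y => taylorMap B (fun y => f (e.symm y)) y b)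
      (base A (chartMap (bundleChart B e he) z)) :=
    contDiffAt_pi.1 (contDiffAt_taylorMap (by rw [hbb]; exact hF)) b
  rw [ev_eq A (bundleChart_mem B he) hz1, taylorMap_congr heq, Module.Basis.equivFun_symm_apply,
    TensorProduct.sum_tmul]
  · exact Finset.sum_congr rfl fun a _ => (TensorProduct.smul_tmul' _ _ _).symm
  · rw [← base_chartMap (bundleChart_mem B he) hz1]
    exact (hsm.congr_of_eventuallyEq heq).of_le (by exact_mod_cast le_top)

theorem taylorMap_clm {G : Type*} [NormedAddCommGroup G] [NormedSpace ℝ G] [FiniteDimensional ℝ G]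
    (L : E →L[ℝ] G) (v : Model A E) (c : Fin (Module.finrank ℝ A)) :
    taylorMap A (fun y => L y) v c = L (v c) := by
  have := FiniteDimensional.complete ℝ E
  have := FiniteDimensional.complete ℝ G
  obtain ⟨γ, hγ, hγ0, rfl⟩ := exists_vjet_eq v
  rw [← vjet_clm hγ.contDiffAt, ← (vjet_comp (F := fun y => L y) L.contDiff.contDiffAt
    (hγ.contDiffAt.of_le (by exact_mod_cast le_top))).2]

theorem taylorMap_taylorMap_clm (e : OpenPartialHomeomorph M E) (L : E →L[ℝ] ℝ)
    {v : Model A (Model B E)} (hv : base B (base A v) ∈ e.target)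
    (a : Fin (Module.finrank ℝ A)) (b : Fin (Module.finrank ℝ B)) :
    taylorMap A (fun y => taylorMap B (fun y => L (e (e.symm y))) y b) v a = L (v a b) := by
  have h1 : (fun y : Model B E => taylorMap B (fun y => L (e (e.symm y))) y b)
      =ᶠ[𝓝 (base A v)] fun y => (L.comp (ContinuousLinearMap.proj b)) y := by
    have hc : ContinuousAt (base B : Model B E → E) (base A v) :=
      contDiff_base.continuous.continuousAt
    filter_upwards [hc.preimage_mem_nhds (e.open_target.mem_nhds hv)] with y hy
    rw [taylorMap_congr (F' := fun y => L y), taylorMap_clm]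
    · rfl
    · filter_upwards [e.open_target.mem_nhds hy] with x hx
      rw [e.right_inv hx]
  rw [taylorMap_congr h1, taylorMap_clm]
  rfl

theorem isExchange_iff (he : e ∈ atlas E M) {z : WeilBundle A (Model B E) (WeilBundle B E M)}
    {w : WeilBundle B (Model A E) (WeilBundle A E M)}
    (hz : proj B E M (proj A _ _ z) ∈ e.source) :
    IsExchange A B z w ↔ proj A E M (proj B _ _ w) ∈ e.source ∧
      chartMap (bundleChart A e he) w = swap A B (chartMap (bundleChart B e he) z) := by
  have hcomm : ∀ t : Fin (Module.finrank ℝ B) → Fin (Module.finrank ℝ A) → ℝ,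
      Algebra.TensorProduct.comm ℝ A B
        (∑ b, ∑ a, t b a • (Module.finBasis ℝ A a ⊗ₜ[ℝ] Module.finBasis ℝ B b)) =
      ∑ a, ∑ b, t b a • (Module.finBasis ℝ B b ⊗ₜ[ℝ] Module.finBasis ℝ A a) := by
    intro t
    rw [Finset.sum_comm]
    simp [map_sum]
  constructor
  · rintro ⟨h1, h2⟩
    have hw : proj A E M (proj B _ _ w) ∈ e.source := by rw [h1]; exact hz
    refine ⟨hw, ?_⟩
    funext b a
    rw [← sub_eq_zero]
    refine SeparatingDual.eq_zero_of_forall_dual_eq_zero (R := ℝ) fun L => ?_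
    have hL : ContMDiffAt 𝓘(ℝ, E) 𝓘(ℝ, ℝ) ∞ (fun x => L (e x)) (proj B E M (proj A _ _ z)) :=
      (L.contDiff.contMDiff (n := ∞)).contMDiffAt.comp _
        (contMDiffAt_of_mem_maximalAtlas (IsManifold.subset_maximalAtlas he) hz)
    have h3 := h2 _ hL
    rw [(ev₂_eq A B he hz hL).2, (ev₂_eq B A he hw (by rw [h1]; exact hL)).2, hcomm] at h3
    have h4 := congrArg (fun t => ((Module.finBasis ℝ B).tensorProduct
      (Module.finBasis ℝ A)).repr t (b, a)) h3
    have hbz : base B (base A (chartMap (bundleChart B e he) z)) ∈ e.target := by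
      rw [base_chartMap (bundleChart_mem B he) hz]
      exact (bundleChart B e he).map_source hz
    have hbw : base A (base B (chartMap (bundleChart A e he) w)) ∈ e.target := by
      rw [base_chartMap (bundleChart_mem A he) hw]
      exact (bundleChart A e he).map_source hw
    simp only [taylorMap_taylorMap_clm A B e L hbz, taylorMap_taylorMap_clm B A e L hbw] at h4
    simp [Finsupp.single_apply] at h4
    rw [map_sub, h4, sub_eq_zero]
    rfl
  · rintro ⟨hw, h⟩
    have hbz : base B (base A (chartMap (bundleChart B e he) z)) =
        e (proj B E M (proj A _ _ z)) := by
      rw [base_chartMap (bundleChart_mem B he) hz]; exact base_chartMap he hz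
    have hbw : base A (base B (chartMap (bundleChart A e he) w)) =
        e (proj A E M (proj B _ _ w)) := by
      rw [base_chartMap (bundleChart_mem A he) hw]; exact base_chartMap he hw
    have h0 : proj A E M (proj B _ _ w) = proj B E M (proj A _ _ z) := by
      apply e.injOn hw hz
      rw [← hbw, ← hbz, h, base_swap]
    refine ⟨h0, fun f hf => ?_⟩
    obtain ⟨hz1, hz2⟩ := ev₂_eq A B he hz hf
    obtain ⟨hw1, hw2⟩ := ev₂_eq B A he hw (by rw [h0]; exact hf)
    rw [hz2, hw2, hcomm, h]
    simp only [taylorMap_swap hz1]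

theorem existsUnique_isExchange (z : WeilBundle A (Model B E) (WeilBundle B E M)) :
    ∃! w : WeilBundle B (Model A E) (WeilBundle A E M), IsExchange A B z w := by
  have he := chart_mem_atlas E (proj B E M (proj A _ _ z))
  set e := chartAt E (proj B E M (proj A _ _ z))
  have hz : proj B E M (proj A _ _ z) ∈ e.source := mem_chart_source E _
  have hbz : base A (base B (swap A B (chartMap (bundleChart B e he) z))) ∈ e.target := by
    rw [base_swap, base_chartMap (bundleChart_mem B he) hz]
    exact (bundleChart B e he).map_source hz
  refine ⟨(bundleChart B _ (bundleChart_mem A he)).symm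
    (swap A B (chartMap (bundleChart B e he) z)), ?_, ?_⟩
  · refine (isExchange_iff A B he hz).2 ⟨?_, (bundleChart B _ (bundleChart_mem A he)).right_inv hbz⟩
    exact (bundleChart B _ (bundleChart_mem A he)).map_target hbz
  · intro w hw
    obtain ⟨hw1, hw2⟩ := (isExchange_iff A B he hz).1 hw
    rw [← hw2]
    exact ((bundleChart B _ (bundleChart_mem A he)).left_inv hw1).symm

/-- The map underlying the exchange transformation `κ^{A,B}_M : T^A T^B M → T^B T^A M`, the natural
transformation corresponding to the exchange homomorphism `A ⊗ B → B ⊗ A`. -/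
noncomputable def exchangeFun (z : WeilBundle A (Model B E) (WeilBundle B E M)) :
    WeilBundle B (Model A E) (WeilBundle A E M) :=
  (existsUnique_isExchange A B z).choose

theorem isExchange_exchangeFun (z : WeilBundle A (Model B E) (WeilBundle B E M)) :
    IsExchange A B z (exchangeFun A B z) :=
  (existsUnique_isExchange A B z).choose_spec.1

variable (E M) in
theorem contMDiff_exchangeFun :
    ContMDiff 𝓘(ℝ, Model A (Model B E)) 𝓘(ℝ, Model B (Model A E)) ∞
      (exchangeFun A B : WeilBundle A (Model B E) (WeilBundle B E M) → _) := by
  intro z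
  have he := chart_mem_atlas E (proj B E M (proj A _ _ z))
  set e := chartAt E (proj B E M (proj A _ _ z))
  have hz : proj B E M (proj A _ _ z) ∈ e.source := mem_chart_source E _
  refine contMDiffAt_of_chart (bundleChart_mem A (bundleChart_mem B he))
    (bundleChart_mem B (bundleChart_mem A he)) hz (Ψ := swap A B) ?_ ?_
  · refine contDiffAt_pi.2 fun b => contDiffAt_pi.2 fun a => ?_
    exact ((contDiff_apply_apply ℝ E a b)).contDiffAt
  · filter_upwards [(bundleChart A _ (bundleChart_mem B he)).open_source.mem_nhds hz] with y hy
    exact (isExchange_iff A B he hy).1 (isExchange_exchangeFun A B y)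

variable (E M) in
/-- The exchange transformation `κ^{A,B}_M : T^A T^B M → T^B T^A M` as a smooth map. -/
noncomputable def exchange :
    C^∞⟮𝓘(ℝ, Model A (Model B E)), WeilBundle A (Model B E) (WeilBundle B E M);
      𝓘(ℝ, Model B (Model A E)), WeilBundle B (Model A E) (WeilBundle A E M)⟯ :=
  ⟨exchangeFun A B, contMDiff_exchangeFun A B E M⟩

end Functor

end Weil

/-! The factor `C` plays almost no role. Everything follows from two facts about the projection
`p^B`.

The first is naturality: `p^B ∘ T^B f = f ∘ p^B` for every smooth `f`, because the velocity of `f ∘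
g` lies over `f (g 0)` (`proj_mapFun`). With `f = κ^{A,C}_M` this moves the projection past `T^B
κ^{A,C}_M`, so the left-hand side becomes `κ^{A,C}_M ∘ p^B ∘ κ^{A,B}_{T^C M}`, where `p^B` is now
the projection of `T^B T^A T^C M`.

The second is `p^B_{T^A N} ∘ κ^{A,B}_N = T^A p^B_N` for every manifold `N` (`proj_exchangeFun`),
used here with `N = T^C M`. In terms of Weil algebras, write `ρ : B → ℝ` for the real part. The
projection `p^B_{T^A N}` corresponds to `ρ ⊗ id : B ⊗ A → A`, while `T^A p^B_N` corresponds to `id ⊗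
ρ : A ⊗ B → A`. The exchange `a ⊗ b ↦ b ⊗ a` followed by the first of these is the second.

The proof of the second fact does not use the correspondence between natural transformations and
algebra homomorphisms; it is a computation in the charts induced by one chart `e` of the base. There
a point of `T^A T^B N` is an array `v a b` of vectors, indexed by bases of `A` and `B`, and three
descriptions are available. The exchange transposes the array (`isExchange_iff`). The outer
projection applies the real part to the outer index (`base_chartMap`). The map `T^A p^B` applies the
real part to the inner index (`chartMap_mapFun_projection`), since `p^B` is linear in charts and
`T^A` of a linear map acts coefficientwise. Both sides therefore have the coordinates `a ↦ ∑ b, ρ(b)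
v a b`, where `ρ(b)` is the real part of the `b`-th basis element. -/

namespace Weil

/-! ### The exchange map followed by the outer projection -/

section ExchangeProjection

variable (A : Type*) [CommRing A] [Algebra ℝ A] [WeilAlgebra A]
variable (B : Type*) [CommRing B] [Algebra ℝ B] [WeilAlgebra B]
variable {E : Type*} [NormedAddCommGroup E] [NormedSpace ℝ E] [FiniteDimensional ℝ E]
variable {M : Type*} [TopologicalSpace M] [ChartedSpace E M] [IsManifold 𝓘(ℝ, E) ∞ M]

variable (E) in
/-- The projection `id ⊗ ρ : E ⊗ A → E` as a continuous linear map. -/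
noncomputable def baseCLM : Model A E →L[ℝ] E :=
  ∑ c, realPart A (Module.finBasis ℝ A c) • ContinuousLinearMap.proj c

/-- `taylorMap_clm` computes `taylorMap` only for bundled continuous linear maps, whereas the
results on charts are phrased with `base`; this identity passes from one form to the other. -/
theorem baseCLM_apply (v : Model A E) : baseCLM A E v = base A v := by
  simp [baseCLM, base]

/-- In the charts induced by `e`, the map `T^A p^B_M` applies `id ⊗ ρ` to the coefficients. -/
theorem chartMap_mapFun_projection {e : OpenPartialHomeomorph M E} (he : e ∈ atlas E M)
    {z : WeilBundle A (Model B E) (WeilBundle B E M)}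
    (hz : proj B E M (proj A _ _ z) ∈ e.source) :
    chartMap e (mapFun A (projection B E M) z) =
      fun a => base B (chartMap (bundleChart B e he) z a) := by
  -- The inner `base A` is the coordinate vector of `p^A z ∈ T^B M` in the chart `T^B e`. Membership
  -- in the target of that chart means, by definition, that its own base point lies in `e.target`.
  have hbase : base B (base A (chartMap (bundleChart B e he) z)) ∈ e.target := by
    rw [base_chartMap (bundleChart_mem B he) hz]
    exact (bundleChart B e he).map_source hz
  -- The local expression of `p^B` is linear only over `e.target`. Continuity of `base B` turns this
  -- open set into a neighbourhood of the point where Taylor coefficients are taken.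
  have hc : ContinuousAt (base B : Model B E → E)
      (base A (chartMap (bundleChart B e he) z)) := contDiff_base.continuous.continuousAt
  -- The same `hz` serves twice: `p^A z` lies in the source of `T^B e` exactly when its projection
  -- to `M` lies in the source of `e`. After this rewrite `T^A p^B` is the Taylor map of `p^B` read
  -- in the charts `T^B e` and `e`. Only the germ of that expression at the base point matters, so
  -- it may be replaced by a globally defined linear map.
  rw [chartMap_mapFun A (bundleChart_mem B he) (projection B E M) he hz hz,
    taylorMap_congr (F' := fun y => baseCLM B E y)]
  · funext a
    -- A linear map `L` has no Taylor terms above the first order, so `T^A L` is `L ⊗ id` and acts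
    -- separately on each coefficient over the basis of `A`.
    rw [taylorMap_clm, baseCLM_apply]
  · filter_upwards [hc.preimage_mem_nhds (e.open_target.mem_nhds hbase)] with y hy
    -- The inverse of the chart `T^B e` covers `e.symm` along `base B`, so the chart expression of
    -- `p^B` reduces to `e (e.symm (base B y))`, where `base B y` lies in `e.target`.
    change e (proj B E M ((bundleChart B e he).symm y)) = _
    rw [proj_bundleChart_symm B he hy, e.right_inv hy, baseCLM_apply]

/-- `p^B_{T^A M} ∘ κ^{A,B}_M = T^A p^B_M`. -/
theorem proj_exchangeFun (z : WeilBundle A (Model B E) (WeilBundle B E M)) :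
    proj B _ _ (exchangeFun A B z) = mapFun A (projection B E M) z := by
  -- A single chart `e` at the point of `M` below `z` induces all the charts needed on `T^A M`, `T^B
  -- M`, `T^A T^B M` and `T^B T^A M`.
  have he := chart_mem_atlas E (proj B E M (proj A _ _ z))
  set e := chartAt E (proj B E M (proj A _ _ z))
  have hz : proj B E M (proj A _ _ z) ∈ e.source := mem_chart_source E _
  -- This replaces the characterization of the exchange through all germs of functions by a concrete
  -- one: in the induced charts the coordinate array is transposed.
  obtain ⟨hw, h⟩ := (isExchange_iff A B he hz).1 (isExchange_exchangeFun A B z)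
  -- Both points lie in `T^A M` over the domain of `e`, so it is enough to compare their coordinates
  -- in the chart `T^A e`.
  refine (bundleChart A e he).injOn hw ?_ ?_
  · rw [bundleChart_source, Set.mem_ofPred_eq, proj_mapFun]
    exact hz
  · rw [bundleChart_apply, bundleChart_apply, chartMap_mapFun_projection A B he hz]
    -- Here `base_chartMap` is applied to the Weil algebra `B` and the manifold `T^A M` with its
    -- chart `T^A e`. The coordinates of the projected point are the `B`-real part of the
    -- coordinates of the exchanged point.
    refine (base_chartMap (bundleChart_mem A he) hw).symm.trans ?_
    rw [h]
    funext a
    -- The `B`-real part of the transposed array is a sum of functions of `a`. Evaluated at `a`, it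
    -- becomes the `B`-real part of the row `v a`, since sums and scalar multiples are pointwise.
    simp only [base, swap, Finset.sum_apply, Pi.smul_apply]

end ExchangeProjection

end Weil

theorem lemma5p1
    (A : Type*) [CommRing A] [Algebra ℝ A] [Weil.WeilAlgebra A]
    (B : Type*) [CommRing B] [Algebra ℝ B] [Weil.WeilAlgebra B]
    (C : Type*) [CommRing C] [Algebra ℝ C] [Weil.WeilAlgebra C]
    (E : Type*) [NormedAddCommGroup E] [NormedSpace ℝ E] [FiniteDimensional ℝ E]
    (M : Type*) [TopologicalSpace M] [ChartedSpace E M] [IsManifold 𝓘(ℝ, E) ∞ M] :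
    (Weil.projection B (Weil.Model C (Weil.Model A E))
        (Weil.WeilBundle C (Weil.Model A E) (Weil.WeilBundle A E M))).comp
      ((Weil.map B (Weil.exchange A C E M)).comp
        (Weil.exchange A B (Weil.Model C E) (Weil.WeilBundle C E M))) =
    (Weil.exchange A C E M).comp
      (Weil.map A (Weil.projection B (Weil.Model C E) (Weil.WeilBundle C E M))) := by
  ext z
  change Weil.proj B _ _ (Weil.mapFun B (Weil.exchange A C E M) (Weil.exchangeFun A B z)) =
    Weil.exchange A C E M
      (Weil.mapFun A (Weil.projection B (Weil.Model C E) (Weil.WeilBundle C E M)) z)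
  -- The naturality step uses only the smoothness of `κ^{A,C}_M`, not its construction. The second
  -- rewrite takes `T^C M`, modelled on `Model C E`, as the base manifold. Both sides are then
  -- `κ^{A,C}_M` at the same point.
  rw [Weil.proj_mapFun, Weil.proj_exchangeFun]
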